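/- Let $n\ge 1$ and let $S^n\subset\mathbb R^{n+1}$ be the unit sphere, equipped with a positive multiple of its surface measure; let $m\in(0,\infty)$ be the total mass. (So $m=\mathrm{vol}(S^n)$ for the surface measure and $m=1$ for the invariant probability measure.) All norms and inner products of functions are those of the real space $L^2(S^n)$ for this measure. Let $\mathcal H_k(S^n)$ be the space of spherical harmonics of degree $k$ (restrictions to $S^n$ of homogeneous polynomials of degree $k$ with vanishing Laplacian), let $F_k(\sigma,\tau)=\sum_i Y_k^i(\sigma)Y_k^i(\tau)$ for an orthonormal basis $(Y_k^i)_i$ of $\mathcal H_k(S^n)$, and let $\varphi_{n,k}$ be the Gegenbauer polynomial normalised by $F_k(\sigma,\tau)=\varphi_{n,k}(\sigma\cdot\tau)$ for all $\sigma,\tau\in S^n$. Let $\theta=\sum_{k=0}^K a_k\varphi_{n,k}$ with $a_k\in\mathbb R$, let $g_\theta=\sum_{k=0}^K a_k^2\varphi_{n,k}$ and $T=\inf_{t\in[-1,1]}|g_\theta'(t)|$. For $x\in S^n$ put $f_x(z)=x\cdot z$. Fix $x^\sharp\in S^n$, $\eta\in L^2(S^n)$ and $y=\theta\circ f_{x^\sharp}+\eta$.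 Suppose that $\eta$ is written, with convergence in $L^2(S^n)$, as $$\eta=\sum_{k=0}^\infty\eta_k,\qquad \eta_k=\sum_{i=1}^{d_k}e_{k,i}F_k(\sigma_{k,i},\cdot)\in\mathcal H_k(S^n),\qquad e_{k,i}\in\mathbb R,\ \sigma_{k,i}\in S^n,$$ and for $x\in S^n$ let $$\epsilon(x)=\Big\|\sum_{k=0}^K a_k\sum_{i=1}^{d_k}e_{k,i}\,\varphi_{n,k}'(x\cdot\sigma_{k,i})\,\sigma_{k,i}\Big\|_{\mathbb R^{n+1}}.$$ (a) Let $\hat x$ be a critical point of $x\mapsto\|\theta\circ f_x-y\|^2$ on $S^n$ and $\epsilon=\epsilon(\hat x)$. If $T+\epsilon>0$, then $$|\hat x\cdot x^\sharp|\ \ge\ 1-\frac{2\epsilon}{T+\epsilon},$$ and the inequality is strict if $\epsilon>0$ and $\epsilon\ne T$. (b) Let $M_k=\max_{t\in[-1,1]}|\varphi_{n,k}'(t)|$. A finite family $(v_i)$ in an inner product space $V$ is called a tight frame with constant $c>0$ if $\sum_i\langle w,v_i\rangle^2=c\|w\|^2$ for all $w\in V$. A family of $N$ points of $S^n$ is called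 a spherical design of strength $s$ if for every polynomial of degree at most $s$ its mean over these points equals its mean over $S^n$. (i) If $\tau_1,\dots,\tau_N\in S^n$ is a spherical design of strength $2k$, then $(F_k(\tau_i,\cdot))_i$ is a tight frame for $\mathcal H_k(S^n)$ with constant $N/m$. (ii) Suppose that for every $1\le k\le K$ the family $(F_k(\sigma_{k,i},\cdot))_i$ is a tight frame for $\mathcal H_k(S^n)$ with some constant $c_k$ and $e_{k,i}=\frac1{c_k}\langle\eta,F_k(\sigma_{k,i},\cdot)\rangle$. Then for every $x\in S^n$ $$\epsilon(x)\ \le\ \sqrt m\,\sum_{k=1}^K M_k|a_k|\,\|\eta_k\|;$$ in particular $\epsilon(x)\le\sum_{k=1}^K M_k|a_k|\|\eta_k\|$ if the measure on $S^n$ is normalised to be a probability measure. (iii) If, in addition, for every $1\le k\le K$ the points $(\sigma_{k,i})_i$ form a spherical design of strength $2k$, then for every $x\in S^n$ $$\epsilon(x)\ \le\ \sqrt{\tfrac{m}{n+1}}\;\sum_{k=1}^K M_k|a_k|\,\|\eta_k\|,$$ so that $\epsilon(x)\le\sum_{k=1}^K M_k|a_k|\|\eta_k\|$ whenever $m\le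 n+1$. -/

import Mathlib

open MeasureTheory
open scoped NNReal Manifold

noncomputable section

namespace SUNLayer

/-- The unit sphere `S^n` in `ℝ^{n+1}`. -/
abbrev Sph (n : ℕ) : Type := Metric.sphere (0 : EuclideanSpace ℝ (Fin (n + 1))) 1

/-- The inner product `x · y` in `ℝ^{n+1}` of two points of the sphere. -/
def dot {n : ℕ} (x y : Sph n) : ℝ :=
  inner ℝ (x : EuclideanSpace ℝ (Fin (n + 1))) (y : EuclideanSpace ℝ (Fin (n + 1)))

/-- The rotation invariant measure `κ · (surface measure)` on `S^n`. The value `κ = 1` gives the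
surface measure, of total mass `vol(S^n)`; `κ = 1 / vol(S^n)` gives the invariant probability
measure. -/
def sphereMeasure (n : ℕ) (κ : ℝ≥0) : Measure (Sph n) :=
  κ • (volume : Measure (EuclideanSpace ℝ (Fin (n + 1)))).toSphere

instance (n : ℕ) (κ : ℝ≥0) : IsFiniteMeasure (sphereMeasure n κ) := by
  unfold sphereMeasure; infer_instance

/-- The total mass `κ vol(S^n)` of `sphereMeasure n κ`. -/
def mass (n : ℕ) (κ : ℝ≥0) : ℝ := (sphereMeasure n κ).real Set.univ

/-- The Hilbert space of square integrable real functions on the sphere. -/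
abbrev L2 (n : ℕ) (κ : ℝ≥0) : Type := Lp ℝ 2 (sphereMeasure n κ)

/-- A continuous function on the sphere as an element of `L²`. -/
def toL2 (n : ℕ) (κ : ℝ≥0) : C(Sph n, ℝ) →ₗ[ℝ] L2 n κ :=
  (ContinuousMap.toLp 2 (sphereMeasure n κ) ℝ).toLinearMap

/-! ### Spherical harmonics -/

/-- The Laplacian `∑ᵢ ∂²/∂xᵢ²` on polynomials in `n + 1` variables. -/
def laplacian (n : ℕ) :
    MvPolynomial (Fin (n + 1)) ℝ →ₗ[ℝ] MvPolynomial (Fin (n + 1)) ℝ :=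
  ∑ i, (MvPolynomial.pderiv i).toLinearMap ∘ₗ (MvPolynomial.pderiv i).toLinearMap

/-- Homogeneous polynomials of degree `k` in `n + 1` variables with vanishing Laplacian. -/
def harmonicPoly (n k : ℕ) : Submodule ℝ (MvPolynomial (Fin (n + 1)) ℝ) :=
  MvPolynomial.homogeneousSubmodule (Fin (n + 1)) ℝ k ⊓ LinearMap.ker (laplacian n)

/-- The restriction of a polynomial to the sphere. -/
def restrictSphere (n : ℕ) : MvPolynomial (Fin (n + 1)) ℝ →ₗ[ℝ] C(Sph n, ℝ) where
  toFun p :=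
    { toFun := fun x => MvPolynomial.eval (x : EuclideanSpace ℝ (Fin (n + 1))).ofLp p
      continuous_toFun := by
        have h := MvPolynomial.continuous_eval p
        have h' : Continuous
            fun x : Sph n => (x : EuclideanSpace ℝ (Fin (n + 1))).ofLp := by fun_prop
        exact h.comp h' }
  map_add' p q := by ext x; simp
  map_smul' c p := by ext x; simp

/-- The space `H_k(S^n)` of spherical harmonics of degree `k`, as a subspace of `L²(S^n)`. -/
def sphericalHarmonics (n : ℕ) (κ : ℝ≥0) (k : ℕ) : Submodule ℝ (L2 n κ) :=
  (harmonicPoly n k).map (toL2 n κ ∘ₗ restrictSphere n)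

instance (n k : ℕ) : FiniteDimensional ℝ (harmonicPoly n k) := by
  have : FiniteDimensional ℝ (MvPolynomial.homogeneousSubmodule (Fin (n + 1)) ℝ k) :=
    Module.Finite.iff_fg.mpr (MvPolynomial.homogeneousSubmodule_fg _ _ _)
  exact Submodule.finiteDimensional_of_le
    (inf_le_left : harmonicPoly n k ≤ MvPolynomial.homogeneousSubmodule (Fin (n + 1)) ℝ k)

instance (n : ℕ) (κ : ℝ≥0) (k : ℕ) : FiniteDimensional ℝ (sphericalHarmonics n κ k) := by
  unfold sphericalHarmonics; infer_instance

/-- The dimension `α_{n,k}` of `H_k(S^n)`. -/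
def harmonicDim (n : ℕ) (κ : ℝ≥0) (k : ℕ) : ℕ :=
  Module.finrank ℝ (sphericalHarmonics n κ k)

/-- An orthonormal basis `Y_k^1, …, Y_k^α` of `H_k(S^n)`. -/
def harmonicBasis (n : ℕ) (κ : ℝ≥0) (k : ℕ) :
    OrthonormalBasis (Fin (harmonicDim n κ k)) ℝ (sphericalHarmonics n κ k) :=
  stdOrthonormalBasis ℝ (sphericalHarmonics n κ k)

theorem exists_harmonicPoly (n : ℕ) (κ : ℝ≥0) (k : ℕ) (i : Fin (harmonicDim n κ k)) :
    ∃ p ∈ harmonicPoly n k,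
      toL2 n κ (restrictSphere n p) = (harmonicBasis n κ k i : L2 n κ) :=
  (harmonicBasis n κ k i).2

/-- The basis element `Y_k^i` as an honest continuous function on the sphere: the restriction of
a harmonic homogeneous polynomial. -/
def harmonicFun (n : ℕ) (κ : ℝ≥0) (k : ℕ) (i : Fin (harmonicDim n κ k)) : C(Sph n, ℝ) :=
  restrictSphere n (exists_harmonicPoly n κ k i).choose

theorem toL2_harmonicFun (n : ℕ) (κ : ℝ≥0) (k : ℕ) (i : Fin (harmonicDim n κ k)) :
    toL2 n κ (harmonicFun n κ k i) = (harmonicBasis n κ k i : L2 n κ) :=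
  (exists_harmonicPoly n κ k i).choose_spec.2

/-! ### Reproducing kernels and Gegenbauer polynomials -/

/-- The continuous function `F_k(σ, ·) = ∑ᵢ Y_k^i(σ) Y_k^i(·)`. -/
def kernelFun (n : ℕ) (κ : ℝ≥0) (k : ℕ) (σ : Sph n) : C(Sph n, ℝ) :=
  ∑ i, harmonicFun n κ k i σ • harmonicFun n κ k i

/-- `F_k(σ, ·)` as an element of the inner product space `H_k(S^n)`. -/
def kernelVec (n : ℕ) (κ : ℝ≥0) (k : ℕ) (σ : Sph n) : sphericalHarmonics n κ k :=
  ∑ i, harmonicFun n κ k i σ • harmonicBasis n κ k i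

theorem coe_kernelVec (n : ℕ) (κ : ℝ≥0) (k : ℕ) (σ : Sph n) :
    (kernelVec n κ k σ : L2 n κ) = toL2 n κ (kernelFun n κ k σ) := by
  simp [kernelVec, kernelFun, toL2_harmonicFun]

/-- The Gegenbauer polynomial `φ_{n,k}`, normalised as the zonal profile of the reproducing
kernel: the polynomial with `F_k(σ, τ) = φ_{n,k}(σ · τ)` for all `σ, τ ∈ S^n`. For `n ≥ 1` the
numbers `σ · τ` fill `[-1, 1]`, so that this determines the polynomial. -/
def gegenbauer (n : ℕ) (κ : ℝ≥0) (k : ℕ) : Polynomial ℝ :=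
  Classical.epsilon fun p : Polynomial ℝ =>
    ∀ σ τ : Sph n, kernelFun n κ k σ τ = p.eval (dot σ τ)

/-! ### The layer and the denoising problem -/

/-- The function `θ ∘ f_x : z ↦ θ(x · z)` on the sphere, in `L²`. -/
def layer (n : ℕ) (κ : ℝ≥0) (θ : Polynomial ℝ) (x : Sph n) : L2 n κ :=
  toL2 n κ
    { toFun := fun z => θ.eval (dot x z)
      continuous_toFun := by
        have h : Continuous fun z : Sph n => dot x z := by unfold dot; fun_prop
        exact θ.continuous.comp h }

/-- The activation `θ = ∑_{k ≤ K} a_k φ_{n,k}`. -/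
def activation (n : ℕ) (κ : ℝ≥0) (K : ℕ) (a : ℕ → ℝ) : Polynomial ℝ :=
  ∑ k ∈ Finset.range (K + 1), a k • gegenbauer n κ k

/-- The function `g_θ = ∑_{k ≤ K} a_k² φ_{n,k}`. -/
def gTheta (n : ℕ) (κ : ℝ≥0) (K : ℕ) (a : ℕ → ℝ) : Polynomial ℝ :=
  ∑ k ∈ Finset.range (K + 1), a k ^ 2 • gegenbauer n κ k

/-- `T = inf_{t ∈ [-1,1]} |g_θ'(t)|`. -/
def slopeInf (n : ℕ) (κ : ℝ≥0) (K : ℕ) (a : ℕ → ℝ) : ℝ :=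
  sInf ((fun t : ℝ => |(gTheta n κ K a).derivative.eval t|) '' Set.Icc (-1) 1)

/-- `M_k = max_{t ∈ [-1,1]} |φ_{n,k}'(t)|`. -/
def slopeMax (n : ℕ) (κ : ℝ≥0) (k : ℕ) : ℝ :=
  sSup ((fun t : ℝ => |(gegenbauer n κ k).derivative.eval t|) '' Set.Icc (-1) 1)

/-- The least squares objective `x ↦ ‖θ ∘ f_x - y‖²` in `L²(S^n)`. -/
def objective (n : ℕ) (κ : ℝ≥0) (θ : Polynomial ℝ) (y : L2 n κ) (x : Sph n) : ℝ :=
  ‖layer n κ θ x - y‖ ^ 2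

/-- A critical point of a function on the manifold `S^n`: the differential vanishes. -/
def IsCriticalPoint {n : ℕ} (J : Sph n → ℝ) (x : Sph n) : Prop :=
  mfderiv (𝓡 n) 𝓘(ℝ, ℝ) J x = 0

/-- The degree `k` part `η_k = ∑_{i < d} e_i F_k(σ_i, ·)` of the noise. -/
def noisePart (n : ℕ) (κ : ℝ≥0) (k : ℕ) {d : ℕ} (e : Fin d → ℝ) (σ : Fin d → Sph n) : L2 n κ :=
  ∑ i, e i • (kernelVec n κ k (σ i) : L2 n κ)

/-- `ε = ‖∑_{k ≤ K} a_k ∑_{i < d_k} e_{k,i} φ_{n,k}'(x · σ_{k,i}) σ_{k,i}‖`, the Euclidean norm of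
the noise gradient at `x`. -/
def noiseGradientNorm (n : ℕ) (κ : ℝ≥0) (K : ℕ) (a : ℕ → ℝ) (d : ℕ → ℕ)
    (e : (k : ℕ) → Fin (d k) → ℝ) (σ : (k : ℕ) → Fin (d k) → Sph n) (x : Sph n) : ℝ :=
  ‖∑ k ∈ Finset.range (K + 1), a k • ∑ i : Fin (d k),
      (e k i * (gegenbauer n κ k).derivative.eval (dot x (σ k i))) •
        (σ k i : EuclideanSpace ℝ (Fin (n + 1)))‖

/-! ### Tight frames and spherical designs -/

/-- A finite family of vectors is a tight frame with constant `c > 0`. -/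
def IsTightFrame {V : Type*} [NormedAddCommGroup V] [InnerProductSpace ℝ V] {ι : Type*}
    [Fintype ι] (v : ι → V) (c : ℝ) : Prop :=
  0 < c ∧ ∀ w : V, ∑ i, inner ℝ w (v i) ^ 2 = c * ‖w‖ ^ 2

/-- A spherical design of strength `s`: for polynomials of degree at most `s`, the mean over the
points equals the (normalised) mean over the sphere. -/
def IsSphericalDesign {n : ℕ} (s : ℕ) {N : ℕ} (σ : Fin N → Sph n) : Prop :=
  ∀ p : MvPolynomial (Fin (n + 1)) ℝ, p.totalDegree ≤ s →
    (1 / (N : ℝ)) * ∑ i, restrictSphere n p (σ i) =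
      ⨍ x, restrictSphere n p x ∂(volume : Measure (EuclideanSpace ℝ (Fin (n + 1)))).toSphere

end SUNLayer

end

/-!
The proof rests on two facts about spherical harmonics.

Harmonics of different degrees are orthogonal (`integral_mul_eq_zero_of_ne`). For harmonic
homogeneous `p` and `q` of degrees `k` and `l`, Euler's identity and integration by parts against
the Gaussian weight give `k E[p q] = E[∇p · ∇q] = l E[p q]`, where `E` is the Gaussian integral, and
in polar coordinates `E[p q]` is a nonzero multiple of the integral of `p q` over the sphere.

The reproducing kernel `F_k(σ, τ)` is a polynomial in `σ · τ` (`kernelFun_eq_gegenbauer`). It is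
invariant under linear isometries because the surface measure and the Laplacian are, so it depends
on `σ · τ` only. On a great circle through `σ` it is a polynomial in the coordinates `t = σ · τ` and
`s` that is even in `s`, and `s ^ 2 = 1 - t ^ 2`.

Critical points: orthogonality makes the objective equal to a constant minus
`2 (g_θ(x · x♯) + ∑ a_k ∑ e_{k,i} φ_{n,k}(x · σ_{k,i}))` (`objective_eq`). At a critical point the
gradient of this in the ambient space is normal to the sphere. Its inner product with the tangential
part of `x♯`, whose length is `√(1 - t²)` for `t = x · x♯`, gives `T √(1 - t²) ≤ ε`
(`slopeInf_sq_mul_le`), and the bound on `|t|` is an elementary consequence.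

Frames and designs: the square of an element of `H_k` has degree at most `2k`, so that a design of
strength `2k` integrates it exactly, and the reproducing property makes this a tight frame. For any
tight frame of `N` kernels with constant `c` the trace of the frame operator shows `N = c m`
(`IsTightFrame.card_eq`). By orthogonality and tightness `∑ e_{k,i} ^ 2 = ‖η_k‖ ^ 2 / c`, and the
Cauchy–Schwarz inequality bounds each degree of the noise gradient
(`norm_noiseGradient_degree_le`). The second moments `∑ (σ_{k,i} · u) ^ 2` in the direction of a
unit vector `u` are at most `N`, and equal to `N / (n + 1)` for a design, which gives the two
bounds.
-/

namespace SUNLayer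

/-! ### Rotations -/

/-- The ambient space `ℝ^{n+1}` of the sphere. -/
abbrev Amb (n : ℕ) : Type := EuclideanSpace ℝ (Fin (n + 1))

theorem restrictSphere_apply (n : ℕ) (p : MvPolynomial (Fin (n + 1)) ℝ) (x : Sph n) :
    restrictSphere n p x = MvPolynomial.eval (x : Amb n).ofLp p := rfl

/-- The rows of the matrix of a linear isometry are orthonormal. -/
theorem sum_coord_mul_coord {n : ℕ} (g : Amb n ≃ₗᵢ[ℝ] Amb n) (i i' : Fin (n + 1)) :
    ∑ j, g (EuclideanSpace.single j 1) i * g (EuclideanSpace.single j 1) i' =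
      if i = i' then 1 else 0 := by
  have h := (EuclideanSpace.basisFun (Fin (n + 1)) ℝ).sum_inner_mul_inner
    (g.symm (EuclideanSpace.single i 1)) (g.symm (EuclideanSpace.single i' 1))
  rw [LinearIsometryEquiv.inner_map_map] at h
  have h2 : ∀ i j, inner ℝ (g.symm (EuclideanSpace.single i 1)) (EuclideanSpace.single j (1:ℝ)) =
      g (EuclideanSpace.single j 1) i := by
    intro i j
    rw [← g.inner_map_map, g.apply_symm_apply]
    simp [EuclideanSpace.inner_single_left]
  simp only [EuclideanSpace.basisFun_apply] at h
  simp only [real_inner_comm (g.symm (EuclideanSpace.single i' 1)), h2] at h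
  rw [h]
  simp [EuclideanSpace.inner_single_left]

/-- The polynomial `p ∘ g`, for a linear isometry `g` of the ambient space. -/
noncomputable def substIsom {n : ℕ} (g : Amb n ≃ₗᵢ[ℝ] Amb n) :
    MvPolynomial (Fin (n + 1)) ℝ →ₐ[ℝ] MvPolynomial (Fin (n + 1)) ℝ :=
  MvPolynomial.aeval fun i =>
    ∑ j, MvPolynomial.C (g (EuclideanSpace.single j 1) i) * MvPolynomial.X j

theorem eval_substIsom {n : ℕ} (g : Amb n ≃ₗᵢ[ℝ] Amb n) (p : MvPolynomial (Fin (n + 1)) ℝ)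
    (x : Amb n) : MvPolynomial.eval x.ofLp (substIsom g p) = MvPolynomial.eval (g x).ofLp p := by
  have hx : ∀ i, ∑ j, g (EuclideanSpace.single j 1) i * x j = g x i := by
    intro i
    have h : x = ∑ j, x j • EuclideanSpace.single j (1 : ℝ) := by
      ext i; simp [Finset.sum_apply, Pi.single_apply]
    conv_rhs => rw [h]
    simp [map_sum, mul_comm]
  induction p using MvPolynomial.induction_on with
  | C a => simp [substIsom]
  | add p q hp hq => simp [hp, hq]
  | mul_X p i hp =>
    rw [map_mul, map_mul, hp, map_mul]
    simp [substIsom, hx]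

theorem pderiv_substIsom {n : ℕ} (g : Amb n ≃ₗᵢ[ℝ] Amb n) (p : MvPolynomial (Fin (n + 1)) ℝ)
    (j : Fin (n + 1)) :
    MvPolynomial.pderiv j (substIsom g p) =
      ∑ i, MvPolynomial.C (g (EuclideanSpace.single j 1) i) *
        substIsom g (MvPolynomial.pderiv i p) := by
  induction p using MvPolynomial.induction_on with
  | C a => simp [substIsom]
  | add p q hp hq => simp [hp, hq, mul_add, Finset.sum_add_distrib]
  | mul_X p i hp =>
    have h1 : MvPolynomial.pderiv j (substIsom g (MvPolynomial.X i)) =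
        MvPolynomial.C (g (EuclideanSpace.single j 1) i) := by
      simp [substIsom, MvPolynomial.pderiv_X, Pi.single_apply, Derivation.leibniz]
    have h2 : ∀ i', substIsom g (MvPolynomial.pderiv i' (p * MvPolynomial.X i)) =
        substIsom g p * (if i = i' then 1 else 0) +
          substIsom g (MvPolynomial.X i) * substIsom g (MvPolynomial.pderiv i' p) := by
      intro i'
      rw [Derivation.leibniz, MvPolynomial.pderiv_X, map_add, smul_eq_mul, smul_eq_mul, map_mul,
        map_mul, Pi.single_apply]
      split_ifs <;> simp
    rw [map_mul, MvPolynomial.pderiv_mul, hp, h1, Finset.sum_mul]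
    simp only [h2, mul_add, Finset.sum_add_distrib]
    refine (add_comm _ _).trans (congrArg₂ (· + ·) ?_ ?_)
    · simp [mul_comm]
    · exact Finset.sum_congr rfl fun _ _ => by ring

theorem laplacian_apply (n : ℕ) (p : MvPolynomial (Fin (n + 1)) ℝ) :
    laplacian n p = ∑ i, MvPolynomial.pderiv i (MvPolynomial.pderiv i p) := by
  simp [laplacian]

theorem laplacian_substIsom {n : ℕ} (g : Amb n ≃ₗᵢ[ℝ] Amb n)
    (p : MvPolynomial (Fin (n + 1)) ℝ) :
    laplacian n (substIsom g p) = substIsom g (laplacian n p) := by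
  simp only [laplacian_apply, pderiv_substIsom, map_sum, Derivation.leibniz, smul_eq_mul,
    MvPolynomial.pderiv_C, mul_zero, add_zero, Finset.mul_sum]
  rw [Finset.sum_comm]
  refine Finset.sum_congr rfl fun i _ => ?_
  rw [Finset.sum_comm]
  have : ∀ i', ∑ j, MvPolynomial.C (g (EuclideanSpace.single j 1) i) *
      (MvPolynomial.C (g (EuclideanSpace.single j 1) i') *
        substIsom g (MvPolynomial.pderiv i' (MvPolynomial.pderiv i p))) =
      if i = i' then substIsom g (MvPolynomial.pderiv i' (MvPolynomial.pderiv i p)) else 0 := by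
    intro i'
    simp only [← mul_assoc, ← MvPolynomial.C_mul, ← Finset.sum_mul, ← map_sum,
      sum_coord_mul_coord]
    split_ifs <;> simp
  simp [this]

theorem isHomogeneous_substIsom {n k : ℕ} (g : Amb n ≃ₗᵢ[ℝ] Amb n)
    {p : MvPolynomial (Fin (n + 1)) ℝ} (hp : p.IsHomogeneous k) :
    (substIsom g p).IsHomogeneous k := by
  have h := hp.aeval (R := ℝ) (n := 1) (fun i : Fin (n + 1) =>
    ∑ j, MvPolynomial.C (g (EuclideanSpace.single j 1) i) * MvPolynomial.X j) (by
      intro i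
      refine MvPolynomial.IsHomogeneous.sum _ _ _ fun j _ => ?_
      simpa using (MvPolynomial.isHomogeneous_C (Fin (n + 1)) _).mul
        (MvPolynomial.isHomogeneous_X ℝ j))
  simpa [substIsom] using h

theorem substIsom_mem_harmonicPoly {n k : ℕ} (g : Amb n ≃ₗᵢ[ℝ] Amb n)
    {p : MvPolynomial (Fin (n + 1)) ℝ} (hp : p ∈ harmonicPoly n k) :
    substIsom g p ∈ harmonicPoly n k := by
  obtain ⟨h1, h2⟩ := hp
  refine ⟨isHomogeneous_substIsom g h1, ?_⟩
  rw [SetLike.mem_coe, LinearMap.mem_ker] at h2 ⊢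
  rw [laplacian_substIsom, h2, map_zero]

/-- The action of a linear isometry on the sphere. -/
noncomputable def rot {n : ℕ} (g : Amb n ≃ₗᵢ[ℝ] Amb n) (x : Sph n) : Sph n :=
  ⟨g x, by simp⟩

theorem coe_rot {n : ℕ} (g : Amb n ≃ₗᵢ[ℝ] Amb n) (x : Sph n) : (rot g x : Amb n) = g x := rfl

theorem continuous_rot {n : ℕ} (g : Amb n ≃ₗᵢ[ℝ] Amb n) : Continuous (rot g) := by
  unfold rot; fun_prop

theorem rot_symm_rot {n : ℕ} (g : Amb n ≃ₗᵢ[ℝ] Amb n) (x : Sph n) : rot g.symm (rot g x) = x := by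
  ext; simp [coe_rot]

theorem rot_rot_symm {n : ℕ} (g : Amb n ≃ₗᵢ[ℝ] Amb n) (x : Sph n) : rot g (rot g.symm x) = x := by
  ext; simp [coe_rot]

theorem dot_rot_rot {n : ℕ} (g : Amb n ≃ₗᵢ[ℝ] Amb n) (x y : Sph n) :
    dot (rot g x) (rot g y) = dot x y := by
  simp [dot, coe_rot]

open scoped Pointwise in
/-- The surface measure is invariant under linear isometries, because the volume of the cone over
a set is. -/
theorem measurePreserving_rot {n : ℕ} (g : Amb n ≃ₗᵢ[ℝ] Amb n) :
    MeasurePreserving (rot g) (volume : Measure (Amb n)).toSphere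
      (volume : Measure (Amb n)).toSphere := by
  refine ⟨(continuous_rot g).measurable, ?_⟩
  ext s hs
  rw [Measure.map_apply (continuous_rot g).measurable hs,
    Measure.toSphere_apply' _ ((continuous_rot g).measurable hs), Measure.toSphere_apply' _ hs]
  congr 1
  have h := g.measurePreserving.measure_preimage_equiv (f := g.toMeasurableEquiv)
    (Set.Ioo (0 : ℝ) 1 • ((↑) '' s : Set (Amb n)))
  rw [← h]
  congr 1
  ext x
  simp only [Set.mem_smul, Set.mem_preimage, Set.mem_image]
  constructor
  · rintro ⟨r, hr, _, ⟨y, hy, rfl⟩, rfl⟩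
    exact ⟨r, hr, _, ⟨rot g y, hy, rfl⟩, by simp [coe_rot]⟩
  · rintro ⟨r, hr, _, ⟨y, hy, rfl⟩, h⟩
    refine ⟨r, hr, _, ⟨rot g.symm y, by rwa [rot_rot_symm], rfl⟩, ?_⟩
    apply g.injective
    simpa [coe_rot] using h

theorem measurePreserving_rot_sphereMeasure {n : ℕ} (κ : ℝ≥0) (g : Amb n ≃ₗᵢ[ℝ] Amb n) :
    MeasurePreserving (rot g) (sphereMeasure n κ) (sphereMeasure n κ) := by
  unfold sphereMeasure
  exact (measurePreserving_rot g).smul_measure κ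

theorem integral_comp_rot {n : ℕ} (κ : ℝ≥0) (g : Amb n ≃ₗᵢ[ℝ] Amb n) (f : Sph n → ℝ) :
    ∫ x, f (rot g x) ∂sphereMeasure n κ = ∫ x, f x ∂sphereMeasure n κ := by
  let e : Sph n ≃ₜ Sph n :=
    { toFun := rot g
      invFun := rot g.symm
      left_inv := rot_symm_rot g
      right_inv := rot_rot_symm g
      continuous_toFun := continuous_rot g
      continuous_invFun := continuous_rot g.symm }
  exact (measurePreserving_rot_sphereMeasure κ g).integral_comp e.measurableEmbedding f

/-! ### Gaussian integrals and orthogonality -/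

theorem eval_smul_of_isHomogeneous {ι : Type*} {d : ℕ} {p : MvPolynomial ι ℝ}
    (hp : p.IsHomogeneous d) (r : ℝ) (x : ι → ℝ) :
    MvPolynomial.eval (r • x) p = r ^ d * MvPolynomial.eval x p := by
  rw [MvPolynomial.eval_eq, MvPolynomial.eval_eq, Finset.mul_sum]
  refine Finset.sum_congr rfl fun s hs => ?_
  have hd : s.degree = d := by
    have := hp (MvPolynomial.mem_support_iff.1 hs)
    rw [Finsupp.degree_eq_weight_one]
    exact this
  simp only [Pi.smul_apply, smul_eq_mul, mul_pow, Finset.prod_mul_distrib,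
    Finset.prod_pow_eq_pow_sum]
  rw [← hd, Finsupp.degree_apply]
  ring

/-- The (unnormalised) Gaussian weight on the ambient space. -/
noncomputable def gauss {n : ℕ} (x : Amb n) : ℝ := Real.exp (-(‖x‖ ^ 2 / 2))

theorem gauss_pos {n : ℕ} (x : Amb n) : 0 < gauss x := Real.exp_pos _

theorem differentiable_gauss {n : ℕ} : Differentiable ℝ (gauss (n := n)) := by
  unfold gauss
  have h : Differentiable ℝ fun x : Amb n => ‖x‖ ^ 2 := differentiable_id.norm_sq ℝ
  have h2 : Differentiable ℝ fun x : Amb n => -(‖x‖ ^ 2 / 2) := by fun_prop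
  exact h2.exp

theorem fderiv_gauss {n : ℕ} (x : Amb n) (i : Fin (n + 1)) :
    fderiv ℝ gauss x (EuclideanSpace.single i 1) = -(x i * gauss x) := by
  have h : HasFDerivAt (gauss (n := n)) _ x :=
    (((hasStrictFDerivAt_norm_sq x).hasFDerivAt.mul_const
      (1 / 2 : ℝ)).neg.exp).congr_of_eventuallyEq
        (Filter.Eventually.of_forall fun y => by simp [gauss, div_eq_mul_inv])
  rw [h.fderiv]
  simp [gauss, EuclideanSpace.inner_single_right, div_eq_mul_inv]
  ring

/-- Polynomials as functions on the ambient space are differentiable, with the formal partial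
derivatives. -/
theorem hasFDerivAt_eval {n : ℕ} (p : MvPolynomial (Fin (n + 1)) ℝ) (x : Amb n) :
    HasFDerivAt (fun y : Amb n => MvPolynomial.eval y.ofLp p)
      (∑ i, MvPolynomial.eval x.ofLp (MvPolynomial.pderiv i p) • EuclideanSpace.proj (𝕜 := ℝ) i)
      x := by
  induction p using MvPolynomial.induction_on with
  | C a => simpa using hasFDerivAt_const a x
  | add p q hp hq =>
    simp only [map_add, add_smul, Finset.sum_add_distrib]
    exact hp.add hq
  | mul_X p j hp =>
    simp only [map_mul, MvPolynomial.eval_X, MvPolynomial.pderiv_mul, map_add,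
      MvPolynomial.pderiv_X]
    have hj : HasFDerivAt (fun y : Amb n => y.ofLp j) (EuclideanSpace.proj (𝕜 := ℝ) j) x :=
      (EuclideanSpace.proj (𝕜 := ℝ) j).hasFDerivAt
    refine (hp.mul hj).congr_fderiv (ContinuousLinearMap.ext fun v => ?_)
    have hs : ∀ i, MvPolynomial.eval x.ofLp (Pi.single (M := fun _ => MvPolynomial _ ℝ) i 1 j) =
        if j = i then 1 else 0 := by
      intro i; rw [Pi.single_apply]; split_ifs <;> simp
    simp [hs, add_mul, Finset.sum_add_distrib, Finset.mul_sum]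
    refine (add_comm _ _).trans (congrArg₂ (· + ·) ?_ ?_)
    · exact Finset.sum_congr rfl fun _ _ => by ring
    · simp

theorem fderiv_eval {n : ℕ} (p : MvPolynomial (Fin (n + 1)) ℝ) (x : Amb n) (i : Fin (n + 1)) :
    fderiv ℝ (fun y : Amb n => MvPolynomial.eval y.ofLp p) x (EuclideanSpace.single i 1) =
      MvPolynomial.eval x.ofLp (MvPolynomial.pderiv i p) := by
  rw [(hasFDerivAt_eval p x).fderiv]
  simp

theorem integrable_norm_pow_mul_gauss (n d : ℕ) :
    Integrable fun x : Amb n => ‖x‖ ^ d * gauss x := by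
  have h := integrable_fun_norm_addHaar (volume : Measure (Amb n))
    (f := fun r : ℝ => r ^ d * Real.exp (-(r ^ 2 / 2)))
  refine h.2 ?_
  have h2 := (integrable_rpow_mul_exp_neg_mul_sq (b := 1 / 2) (by norm_num)
    (s := ((n + d : ℕ) : ℝ)) (by linarith [Nat.cast_nonneg (α := ℝ) (n + d)])).integrableOn
    (s := Set.Ioi 0)
  refine h2.congr_fun (fun r hr => ?_) measurableSet_Ioi
  simp only [Real.rpow_natCast, finrank_euclideanSpace, Fintype.card_fin, Nat.add_sub_cancel,
    smul_eq_mul]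
  rw [pow_add, mul_assoc]
  congr 3
  ring

theorem integrable_eval_mul_gauss {n : ℕ} (p : MvPolynomial (Fin (n + 1)) ℝ) :
    Integrable fun x : Amb n => MvPolynomial.eval x.ofLp p * gauss x := by
  induction p using MvPolynomial.monomial_add_induction_on with
  | C a =>
    simpa using (integrable_norm_pow_mul_gauss n 0).const_mul a
  | monomial_add s a p hs ha hp =>
    simp only [map_add, add_mul]
    refine Integrable.add ?_ hp
    refine ((integrable_norm_pow_mul_gauss n (∑ i, s i)).const_mul |a|).mono' ?_ ?_
    · refine Continuous.aestronglyMeasurable ?_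
      exact ((MvPolynomial.continuous_eval _).comp (by fun_prop)).mul
        differentiable_gauss.continuous
    · refine Filter.Eventually.of_forall fun x => ?_
      rw [norm_mul, Real.norm_of_nonneg (gauss_pos x).le, ← mul_assoc]
      refine mul_le_mul_of_nonneg_right ?_ (gauss_pos x).le
      rw [MvPolynomial.eval_monomial, norm_mul, Real.norm_eq_abs]
      gcongr
      rw [Finsupp.prod_fintype _ _ (by simp), norm_prod, ← Finset.prod_pow_eq_pow_sum]
      gcongr with i
      rw [norm_pow]
      gcongr
      exact PiLp.norm_apply_le x i

/-- Gaussian integration by parts (Stein's identity). -/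
theorem integral_pderiv_mul_gauss {n : ℕ} (p : MvPolynomial (Fin (n + 1)) ℝ) (i : Fin (n + 1)) :
    ∫ x : Amb n, MvPolynomial.eval x.ofLp (MvPolynomial.pderiv i p) * gauss x =
      ∫ x : Amb n, MvPolynomial.eval x.ofLp (MvPolynomial.X i * p) * gauss x := by
  have hX : ∀ x : Amb n, MvPolynomial.eval x.ofLp p *
      fderiv ℝ gauss x (EuclideanSpace.single i 1) =
      -(MvPolynomial.eval x.ofLp (MvPolynomial.X i * p) * gauss x) := by
    intro x
    rw [fderiv_gauss, map_mul, MvPolynomial.eval_X]; ring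
  have h := integral_mul_fderiv_eq_neg_fderiv_mul_of_integrable (μ := (volume : Measure (Amb n)))
    (f := fun x : Amb n => MvPolynomial.eval x.ofLp p) (g := gauss)
    (v := EuclideanSpace.single i (1 : ℝ)) (by
      simp only [fderiv_eval]; exact integrable_eval_mul_gauss _) (by
      simp only [hX]; exact (integrable_eval_mul_gauss _).neg)
    (integrable_eval_mul_gauss _) (fun x _ => (hasFDerivAt_eval p x).differentiableAt)
    (fun x _ => differentiable_gauss x)
  simp only [hX, fderiv_eval, integral_neg, neg_inj] at h
  exact h.symm

/-- Integration in polar coordinates: the Gaussian integral of a homogeneous function is a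
multiple, depending only on the degree, of its integral over the sphere. -/
theorem exists_integral_mul_gauss_eq (n d : ℕ) :
    ∃ C : ℝ, ∀ F : Amb n → ℝ, (∀ x : Amb n, ∀ r : ℝ, 0 < r → F (r • x) = r ^ d * F x) →
      ∫ x : Amb n, F x * gauss x =
        C * ∫ x : Sph n, F x ∂(volume : Measure (Amb n)).toSphere := by
  let w : Set.Ioi (0 : ℝ) → ℝ := fun r => (r : ℝ) ^ d * Real.exp (-((r : ℝ) ^ 2 / 2))
  refine ⟨∫ r, w r ∂Measure.volumeIoiPow n, fun F hF => ?_⟩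
  let f : Sph n × Set.Ioi (0 : ℝ) → ℝ := fun z => F z.1 * w z.2
  calc
    _ = ∫ x : ({(0)}ᶜ : Set (Amb n)), F x * gauss (x : Amb n)
        ∂((volume : Measure (Amb n)).comap (↑)) := by
      rw [integral_subtype_comap (measurableSet_singleton _).compl
        fun x : Amb n => F x * gauss x, restrict_compl_singleton]
    _ = ∫ z, f z ∂(volume : Measure (Amb n)).toSphere.prod (.volumeIoiPow n) := by
      have h := (volume : Measure (Amb n)).measurePreserving_homeomorphUnitSphereProd.integral_comp
        (Homeomorph.measurableEmbedding _) f
      simp only [finrank_euclideanSpace, Fintype.card_fin, Nat.add_sub_cancel] at h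
      rw [← h]
      refine integral_congr_ae (Filter.Eventually.of_forall fun x => ?_)
      have hx : 0 < ‖(x : Amb n)‖ := norm_pos_iff.2 x.2
      simp only [f, w, homeomorphUnitSphereProd_apply_snd_coe,
        homeomorphUnitSphereProd_apply_fst_coe, gauss]
      rw [hF _ _ (inv_pos.2 hx), inv_pow]
      field_simp
    _ = (∫ x : Sph n, F x ∂(volume : Measure (Amb n)).toSphere) *
        ∫ r, w r ∂Measure.volumeIoiPow n :=
      integral_prod_mul (fun x : Sph n => F x) w
    _ = _ := mul_comm _ _

theorem integral_norm_pow_mul_gauss_pos (n d : ℕ) : 0 < ∫ x : Amb n, ‖x‖ ^ d * gauss x := by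
  rw [integral_pos_iff_support_of_nonneg
    (fun x => mul_nonneg (by positivity) (gauss_pos x).le) (integrable_norm_pow_mul_gauss n d)]
  have hsub : ({0}ᶜ : Set (Amb n)) ⊆ Function.support fun x : Amb n => ‖x‖ ^ d * gauss x := by
    intro x hx
    exact mul_ne_zero (pow_ne_zero _ (norm_ne_zero_iff.2 hx)) (gauss_pos x).ne'
  refine lt_of_lt_of_le ?_ (measure_mono hsub)
  refine isOpen_compl_singleton.measure_pos _ ⟨EuclideanSpace.single 0 1, ?_⟩
  simp

/-- A homogeneous polynomial with vanishing Gaussian integral has vanishing integral over the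
sphere. -/
theorem integral_sphere_eq_zero_of_integral_gauss_eq_zero {n d : ℕ}
    {p : MvPolynomial (Fin (n + 1)) ℝ} (hp : p.IsHomogeneous d)
    (h0 : ∫ x : Amb n, MvPolynomial.eval x.ofLp p * gauss x = 0) :
    ∫ x, restrictSphere n p x ∂(volume : Measure (Amb n)).toSphere = 0 := by
  obtain ⟨C, hC⟩ := exists_integral_mul_gauss_eq n d
  -- the function `‖x‖ ^ d` has a positive Gaussian integral
  have hC0 : C ≠ 0 := by
    rintro rfl
    have h := hC (fun x => ‖x‖ ^ d) fun x r hr => by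
      rw [norm_smul, mul_pow, Real.norm_of_nonneg hr.le]
    rw [zero_mul] at h
    exact (integral_norm_pow_mul_gauss_pos n d).ne' h
  have h := hC (fun x => MvPolynomial.eval x.ofLp p) fun x r _ =>
    eval_smul_of_isHomogeneous hp r x.ofLp
  rw [h0] at h
  exact (mul_eq_zero.1 h.symm).resolve_left hC0

/-- Harmonic polynomials of different degrees are orthogonal: by Euler's identity, Stein's identity
and harmonicity, both degrees multiply the Gaussian integral of `p q` to that of
`∇p · ∇q`. -/
theorem integral_mul_eq_zero_of_ne {n k l : ℕ} (hkl : k ≠ l) {p q : MvPolynomial (Fin (n + 1)) ℝ}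
    (hp : p ∈ harmonicPoly n k) (hq : q ∈ harmonicPoly n l) :
    ∫ x, restrictSphere n (p * q) x ∂(volume : Measure (Amb n)).toSphere = 0 := by
  let G : MvPolynomial (Fin (n + 1)) ℝ → ℝ := fun p =>
    ∫ x : Amb n, MvPolynomial.eval x.ofLp p * gauss x
  have hGs : ∀ f : Fin (n + 1) → MvPolynomial (Fin (n + 1)) ℝ, G (∑ i, f i) = ∑ i, G (f i) := by
    intro f
    simp only [G, map_sum, Finset.sum_mul]
    exact integral_finsetSum _ fun i _ => integrable_eval_mul_gauss _
  have hGa : ∀ p q, G (p + q) = G p + G q := by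
    intro p q
    simp only [G, map_add, add_mul]
    exact integral_add (integrable_eval_mul_gauss _) (integrable_eval_mul_gauss _)
  have hGm : ∀ (c : ℕ) p, G (c • p) = c * G p := by
    intro c p
    simp only [G, nsmul_eq_mul, map_mul, map_natCast, mul_assoc]
    exact integral_const_mul _ _
  have key : ∀ {k : ℕ} {p q : MvPolynomial (Fin (n + 1)) ℝ}, p ∈ harmonicPoly n k →
      (k : ℝ) * G (p * q) = ∑ i, G (MvPolynomial.pderiv i p * MvPolynomial.pderiv i q) := by
    intro k p q hp
    have hΔ : laplacian n p = 0 := hp.2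
    have hE : p.IsHomogeneous k := hp.1
    rw [laplacian_apply] at hΔ
    calc (k : ℝ) * G (p * q) = G ((k • p) * q) := by rw [smul_mul_assoc, hGm]
      _ = ∑ i, G (MvPolynomial.X i * (MvPolynomial.pderiv i p * q)) := by
        rw [← hE.sum_X_mul_pderiv, Finset.sum_mul, hGs]
        simp only [mul_assoc]
      _ = ∑ i, (G (MvPolynomial.pderiv i (MvPolynomial.pderiv i p) * q) +
            G (MvPolynomial.pderiv i p * MvPolynomial.pderiv i q)) := by
        refine Finset.sum_congr rfl fun i _ => ?_
        rw [← hGa, ← MvPolynomial.pderiv_mul]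
        exact (integral_pderiv_mul_gauss _ i).symm
      _ = _ := by
        rw [Finset.sum_add_distrib, ← hGs, ← Finset.sum_mul, hΔ, zero_mul]
        simp [G]
  have h1 := key (q := q) hp
  have h2 := key (q := p) hq
  rw [mul_comm q p] at h2
  simp only [mul_comm (MvPolynomial.pderiv _ q)] at h2
  have h3 : ((k : ℝ) - l) * G (p * q) = 0 := by rw [sub_mul, h1, h2, sub_self]
  have h4 : G (p * q) = 0 := by
    rcases mul_eq_zero.1 h3 with h | h
    · exact absurd (by exact_mod_cast sub_eq_zero.1 h) hkl
    · exact h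
  exact integral_sphere_eq_zero_of_integral_gauss_eq_zero
    (MvPolynomial.IsHomogeneous.mul hp.1 hq.1) h4

/-! ### The reproducing kernel -/

theorem inner_toL2 {n : ℕ} {κ : ℝ≥0} (f g : C(Sph n, ℝ)) :
    inner ℝ (toL2 n κ f) (toL2 n κ g) = ∫ x, f x * g x ∂sphereMeasure n κ := by
  have h := ContinuousMap.inner_toLp (𝕜 := ℝ) (μ := sphereMeasure n κ) f g
  simp only [conj_trivial, mul_comm (g _)] at h
  exact h

theorem norm_toL2_sq {n : ℕ} {κ : ℝ≥0} (f : C(Sph n, ℝ)) :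
    ‖toL2 n κ f‖ ^ 2 = ∫ x, f x ^ 2 ∂sphereMeasure n κ := by
  rw [← real_inner_self_eq_norm_sq, inner_toL2]
  simp only [sq]

theorem toL2_injective {n : ℕ} {κ : ℝ≥0} (hκ : 0 < κ) : Function.Injective (toL2 n κ) := by
  have : (sphereMeasure n κ).IsOpenPosMeasure := ⟨fun U hU hne => by
    have h := hU.measure_ne_zero (volume : Measure (Amb n)).toSphere hne
    simp [sphereMeasure, hκ.ne', h]⟩
  exact ContinuousMap.toLp_injective (E := ℝ) (p := 2) (𝕜 := ℝ) (sphereMeasure n κ)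

theorem inner_eq_zero_of_ne {n k l : ℕ} {κ : ℝ≥0} (hkl : k ≠ l) {v w : L2 n κ}
    (hv : v ∈ sphericalHarmonics n κ k) (hw : w ∈ sphericalHarmonics n κ l) :
    inner ℝ v w = 0 := by
  obtain ⟨p, hp, rfl⟩ := hv
  obtain ⟨q, hq, rfl⟩ := hw
  have h := integral_mul_eq_zero_of_ne hkl hp hq
  simp only [restrictSphere_apply, map_mul] at h
  refine (inner_toL2 _ _).trans ?_
  simp only [sphereMeasure, restrictSphere_apply, integral_smul_nnreal_measure, h, smul_zero]

/-- The reproducing property of the kernel `F_k`. -/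
theorem inner_kernelVec {n k : ℕ} {κ : ℝ≥0} (hκ : 0 < κ) {p : MvPolynomial (Fin (n + 1)) ℝ}
    (hp : p ∈ harmonicPoly n k) (σ : Sph n) :
    inner ℝ (toL2 n κ (restrictSphere n p)) (kernelVec n κ k σ : L2 n κ) =
      restrictSphere n p σ := by
  let w : sphericalHarmonics n κ k := ⟨toL2 n κ (restrictSphere n p), p, hp, rfl⟩
  have hw : restrictSphere n p = ∑ i, inner ℝ (harmonicBasis n κ k i) w • harmonicFun n κ k i := by
    apply toL2_injective hκ
    have h := congrArg (Subtype.val) ((harmonicBasis n κ k).sum_repr' w)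
    simp only [map_sum, map_smul, toL2_harmonicFun]
    simpa [w] using h.symm
  rw [hw]
  have : toL2 n κ (restrictSphere n p) = (w : L2 n κ) := rfl
  rw [← hw, this, ← Submodule.coe_inner, kernelVec, inner_sum]
  conv_rhs => rw [hw]
  simp only [ContinuousMap.sum_apply, ContinuousMap.smul_apply, smul_eq_mul, inner_smul_right]
  exact Finset.sum_congr rfl fun i _ => by rw [real_inner_comm, mul_comm]

theorem kernelVec_mem (n : ℕ) (κ : ℝ≥0) (k : ℕ) (σ : Sph n) :
    (kernelVec n κ k σ : L2 n κ) ∈ sphericalHarmonics n κ k := (kernelVec n κ k σ).2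

theorem exists_harmonicPoly_kernelFun (n : ℕ) (κ : ℝ≥0) (k : ℕ) (σ : Sph n) :
    ∃ p ∈ harmonicPoly n k, kernelFun n κ k σ = restrictSphere n p := by
  refine ⟨∑ i, harmonicFun n κ k i σ • (exists_harmonicPoly n κ k i).choose,
    Submodule.sum_mem _ fun i _ => Submodule.smul_mem _ _
      (exists_harmonicPoly n κ k i).choose_spec.1, ?_⟩
  simp only [map_sum, map_smul]
  rfl

theorem kernelFun_comm {n k : ℕ} {κ : ℝ≥0} (σ τ : Sph n) :
    kernelFun n κ k σ τ = kernelFun n κ k τ σ := by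
  simp [kernelFun, mul_comm]

theorem inner_kernelVec_kernelVec {n k : ℕ} {κ : ℝ≥0} (hκ : 0 < κ) (σ τ : Sph n) :
    inner ℝ (kernelVec n κ k σ : L2 n κ) (kernelVec n κ k τ : L2 n κ) = kernelFun n κ k σ τ := by
  obtain ⟨p, hp, h⟩ := exists_harmonicPoly_kernelFun n κ k σ
  rw [coe_kernelVec n κ k σ, h, inner_kernelVec hκ hp]

/-- The kernel is invariant under linear isometries, since the measure and the space of harmonic
polynomials are, and the reproducing property determines the kernel. -/
theorem kernelFun_rot_rot {n k : ℕ} {κ : ℝ≥0} (hκ : 0 < κ) (g : Amb n ≃ₗᵢ[ℝ] Amb n) (σ τ : Sph n) :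
    kernelFun n κ k (rot g σ) (rot g τ) = kernelFun n κ k σ τ := by
  obtain ⟨p, hp, h⟩ := exists_harmonicPoly_kernelFun n κ k (rot g σ)
  obtain ⟨q, hq, h'⟩ := exists_harmonicPoly_kernelFun n κ k τ
  have hs : ∀ p x, restrictSphere n (substIsom g p) x = restrictSphere n p (rot g x) :=
    fun p x => eval_substIsom g p x
  have h1 := inner_kernelVec hκ (substIsom_mem_harmonicPoly g hp) τ
  have h2 := inner_kernelVec hκ (substIsom_mem_harmonicPoly g.symm hq) (rot g σ)
  have hs' : ∀ p x, restrictSphere n (substIsom g.symm p) x = restrictSphere n p (rot g.symm x) :=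
    fun p x => eval_substIsom g.symm p x
  rw [coe_kernelVec, inner_toL2, h', ← integral_comp_rot κ g.symm] at h1
  rw [coe_kernelVec, inner_toL2, h] at h2
  simp only [hs, hs', rot_rot_symm, rot_symm_rot] at h1 h2
  rw [h, ← h1, kernelFun_comm, h', ← h2]
  simp only [mul_comm]

/-! ### Zonality -/

theorem exists_rot_eq {n : ℕ} (x y : Sph n) : ∃ g : Amb n ≃ₗᵢ[ℝ] Amb n, rot g x = y := by
  refine ⟨(ℝ ∙ ((x : Amb n) - y))ᗮ.reflection, Subtype.ext ?_⟩
  exact Submodule.reflection_sub (by simp)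

/-- On the unit circle `s ^ 2 = 1 - t ^ 2`, so the part of a polynomial that is even in `s` is a
polynomial in `t`. It agrees with the polynomial itself wherever `s ↦ -s` does not change the
value. -/
theorem exists_polynomial_of_even (P : MvPolynomial (Fin 2) ℝ) :
    ∃ φ : Polynomial ℝ, ∀ t s : ℝ, t ^ 2 + s ^ 2 = 1 →
      MvPolynomial.eval ![t, s] P = MvPolynomial.eval ![t, -s] P →
      MvPolynomial.eval ![t, s] P = φ.eval t := by
  suffices H : ∃ φ : Polynomial ℝ, ∀ t s : ℝ, t ^ 2 + s ^ 2 = 1 →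
      (MvPolynomial.eval ![t, s] P + MvPolynomial.eval ![t, -s] P) / 2 = φ.eval t by
    obtain ⟨φ, h⟩ := H
    refine ⟨φ, fun t s hts he => ?_⟩
    rw [← h t s hts, ← he]; ring
  induction P using MvPolynomial.monomial_add_induction_on with
  | C a => exact ⟨Polynomial.C a, fun t s _ => by simp⟩
  | monomial_add d a p _ _ hp =>
    obtain ⟨φ, hφ⟩ := hp
    rcases Nat.even_or_odd (d 1) with he | ho
    · obtain ⟨m, hm⟩ := he
      refine ⟨Polynomial.C a * Polynomial.X ^ d 0 * (1 - Polynomial.X ^ 2) ^ m + φ,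
        fun t s hts => ?_⟩
      have h1 : s ^ d 1 = (1 - t ^ 2) ^ m := by
        rw [hm, ← two_mul, pow_mul]; congr 1; linarith
      have h2 : (-s) ^ d 1 = (1 - t ^ 2) ^ m := by
        rw [Even.neg_pow ⟨m, hm⟩, h1]
      have := hφ t s hts
      simp only [map_add, MvPolynomial.eval_monomial, Finsupp.prod_fintype, pow_zero, implies_true,
        Fin.prod_univ_two, Matrix.cons_val_zero, Matrix.cons_val_one, h1, h2, Polynomial.eval_add,
        Polynomial.eval_mul, Polynomial.eval_C, Polynomial.eval_pow, Polynomial.eval_X,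
        Polynomial.eval_sub, Polynomial.eval_one]
      linarith
    · refine ⟨φ, fun t s hts => ?_⟩
      have h2 : (-s) ^ d 1 = -s ^ d 1 := ho.neg_pow s
      have := hφ t s hts
      simp only [map_add, MvPolynomial.eval_monomial, Finsupp.prod_fintype, pow_zero, implies_true,
        Fin.prod_univ_two, Matrix.cons_val_zero, Matrix.cons_val_one, h2]
      linarith

/-- The kernel depends on the inner product alone, since the linear isometries act transitively on
pairs of points of the sphere with a given inner product. -/
theorem kernelFun_eq_of_dot {n k : ℕ} {κ : ℝ≥0} (hκ : 0 < κ) {σ τ σ' τ' : Sph n}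
    (h : dot σ τ = dot σ' τ') : kernelFun n κ k σ τ = kernelFun n κ k σ' τ' := by
  obtain ⟨g, hg⟩ := exists_rot_eq σ σ'
  rw [← kernelFun_rot_rot hκ g, hg]
  have h' : dot σ' (rot g τ) = dot σ' τ' := by rw [← h, ← dot_rot_rot g σ, hg]
  set τ₁ := rot g τ
  -- the reflection exchanging `τ₁` and `τ'` fixes `σ'`, which is orthogonal to `τ₁ - τ'`
  let R := (ℝ ∙ ((τ₁ : Amb n) - τ'))ᗮ.reflection
  have h1 : rot R τ₁ = τ' := Subtype.ext (Submodule.reflection_sub (by simp))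
  have h2 : rot R σ' = σ' := by
    refine Subtype.ext (Submodule.reflection_mem_subspace_eq_self ?_)
    rw [Submodule.mem_orthogonal_singleton_iff_inner_left, inner_sub_right]
    exact sub_eq_zero.2 h'
  rw [← kernelFun_rot_rot hκ R, h1, h2]

theorem dot_mem_Icc {n : ℕ} (x y : Sph n) : dot x y ∈ Set.Icc (-1 : ℝ) 1 := by
  have h := abs_real_inner_le_norm (x : Amb n) (y : Amb n)
  simp only [norm_eq_of_mem_sphere, mul_one] at h
  exact abs_le.1 h

theorem dot_self {n : ℕ} (x : Sph n) : dot x x = 1 := by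
  simp [dot]

theorem dot_comm {n : ℕ} (x y : Sph n) : dot x y = dot y x := real_inner_comm _ _

/-- The point `t eᵢ + s eⱼ` of the sphere, where `t ^ 2 + s ^ 2 = 1`. -/
noncomputable def circlePoint {n : ℕ} {i j : Fin (n + 1)} (hij : i ≠ j) (t s : ℝ)
    (h : t ^ 2 + s ^ 2 = 1) : Sph n :=
  ⟨EuclideanSpace.single i t + EuclideanSpace.single j s, by
    rw [mem_sphere_zero_iff_norm, ← sq_eq_sq₀ (norm_nonneg _) zero_le_one,
      norm_add_sq_real]
    simp [EuclideanSpace.inner_single_left, hij, h]⟩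

theorem dot_circlePoint {n : ℕ} {i j : Fin (n + 1)} (hij : i ≠ j) (t s t' s' : ℝ)
    (h : t ^ 2 + s ^ 2 = 1) (h' : t' ^ 2 + s' ^ 2 = 1) :
    dot (circlePoint hij t s h) (circlePoint hij t' s' h') = t * t' + s * s' := by
  simp [dot, circlePoint, inner_add_left, inner_add_right, EuclideanSpace.inner_single_left, hij,
    hij.symm]

theorem exists_dot_eq {n : ℕ} (hn : 1 ≤ n) {t : ℝ} (ht : t ∈ Set.Icc (-1 : ℝ) 1) :
    ∃ x y : Sph n, dot x y = t := by
  have hij : (0 : Fin (n + 1)) ≠ Fin.last n := by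
    rw [Ne, Fin.ext_iff]; simp; omega
  refine ⟨circlePoint hij 1 0 (by norm_num), circlePoint hij t √(1 - t ^ 2) ?_, ?_⟩
  · rw [Real.sq_sqrt (by nlinarith [ht.1, ht.2])]; ring
  · simp [dot_circlePoint]

/-- The kernel is zonal: `F_k(σ, τ)` is a polynomial in `σ · τ`. -/
theorem exists_kernelFun_eq_eval {n : ℕ} (hn : 1 ≤ n) {κ : ℝ≥0} (hκ : 0 < κ) (k : ℕ) :
    ∃ φ : Polynomial ℝ, ∀ σ τ : Sph n, kernelFun n κ k σ τ = φ.eval (dot σ τ) := by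
  have hij : (0 : Fin (n + 1)) ≠ Fin.last n := by
    rw [Ne, Fin.ext_iff]; simp; omega
  -- `P (t, s)` is the value of `F_k(e, ·)` at the point `t e₀ + s eₙ`, where `e = e₀`
  let e : Sph n := circlePoint hij 1 0 (by norm_num)
  obtain ⟨p, -, hp⟩ := exists_harmonicPoly_kernelFun n κ k e
  let P : MvPolynomial (Fin 2) ℝ := MvPolynomial.aeval (fun l : Fin (n + 1) =>
    MvPolynomial.C (EuclideanSpace.single (0 : Fin (n + 1)) (1 : ℝ) l) * MvPolynomial.X 0 +
      MvPolynomial.C (EuclideanSpace.single (Fin.last n) (1 : ℝ) l) * MvPolynomial.X 1) p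
  have hP : ∀ t s h, MvPolynomial.eval ![t, s] P = kernelFun n κ k e (circlePoint hij t s h) := by
    intro t s h
    rw [hp, restrictSphere_apply, ← MvPolynomial.coe_aeval_eq_eval,
      ← MvPolynomial.coe_aeval_eq_eval]
    simp only [P, RingHom.coe_coe]
    rw [← AlgHom.comp_apply, MvPolynomial.comp_aeval]
    congr 2
    funext l
    simp only [map_add, map_mul, MvPolynomial.aeval_C, MvPolynomial.aeval_X, circlePoint]
    simp
  -- both signs of `s` give points with the same inner product with `e`, so `P` is even in `s`
  obtain ⟨φ, hφ⟩ := exists_polynomial_of_even P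
  refine ⟨φ, fun σ τ => ?_⟩
  have ht := dot_mem_Icc σ τ
  set t := dot σ τ
  have hts : t ^ 2 + √(1 - t ^ 2) ^ 2 = 1 := by
    rw [Real.sq_sqrt (by nlinarith [ht.1, ht.2])]; ring
  have hts' : t ^ 2 + (-√(1 - t ^ 2)) ^ 2 = 1 := by rwa [neg_sq]
  rw [← hφ t _ hts, hP t _ hts]
  · exact kernelFun_eq_of_dot hκ (by simp [e, dot_circlePoint, t])
  · rw [hP t _ hts, hP t _ hts']
    exact kernelFun_eq_of_dot hκ (by simp [e, dot_circlePoint])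

/-- The defining property of `gegenbauer`, which holds because a zonal profile exists. -/
theorem kernelFun_eq_gegenbauer {n : ℕ} (hn : 1 ≤ n) {κ : ℝ≥0} (hκ : 0 < κ) (k : ℕ) (σ τ : Sph n) :
    kernelFun n κ k σ τ = (gegenbauer n κ k).eval (dot σ τ) :=
  Classical.epsilon_spec (exists_kernelFun_eq_eval hn hκ k) σ τ

/-- A polynomial vanishing at all inner products of points of the sphere vanishes. -/
theorem polynomial_eq_of_eval_dot {n : ℕ} (hn : 1 ≤ n) {p q : Polynomial ℝ}
    (h : ∀ σ τ : Sph n, p.eval (dot σ τ) = q.eval (dot σ τ)) : p = q := by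
  refine Polynomial.eq_of_infinite_eval_eq p q
    ((Set.Icc_infinite (by norm_num : (-1 : ℝ) < 1)).mono fun t ht => ?_)
  obtain ⟨x, y, rfl⟩ := exists_dot_eq hn ht
  exact h x y

theorem derivative_gegenbauer_zero {n : ℕ} (hn : 1 ≤ n) {κ : ℝ≥0} (hκ : 0 < κ) :
    (gegenbauer n κ 0).derivative = 0 := by
  obtain ⟨x, -, -⟩ := exists_dot_eq hn (t := 0) (by simp)
  obtain ⟨p, hp, h⟩ := exists_harmonicPoly_kernelFun n κ 0 x
  obtain ⟨c, rfl⟩ : ∃ c, MvPolynomial.C c = p :=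
    ⟨_, ((MvPolynomial.totalDegree_eq_zero_iff_eq_C).1
      (Nat.le_zero.1 (MvPolynomial.IsHomogeneous.totalDegree_le hp.1))).symm⟩
  have : gegenbauer n κ 0 = Polynomial.C c := by
    refine polynomial_eq_of_eval_dot hn fun σ τ => ?_
    rw [← kernelFun_eq_gegenbauer hn hκ]
    obtain ⟨g, hg⟩ := exists_rot_eq σ x
    rw [← kernelFun_rot_rot hκ g, hg, h, restrictSphere_apply]
    simp
  rw [this, Polynomial.derivative_C]

/-! ### Expansion of the layer and of the noise -/

theorem noisePart_mem (n : ℕ) (κ : ℝ≥0) (k : ℕ) {d : ℕ} (e : Fin d → ℝ) (σ : Fin d → Sph n) :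
    noisePart n κ k e σ ∈ sphericalHarmonics n κ k :=
  Submodule.sum_mem _ fun i _ => Submodule.smul_mem _ _ (kernelVec_mem n κ k (σ i))

/-- The noise acts on `H_k` through its degree `k` part only. -/
theorem inner_eq_inner_of_hasSum {n : ℕ} {κ : ℝ≥0} {f : ℕ → L2 n κ} {η : L2 n κ}
    (hf : ∀ k, f k ∈ sphericalHarmonics n κ k) (h : HasSum f η) {k : ℕ} {v : L2 n κ}
    (hv : v ∈ sphericalHarmonics n κ k) : inner ℝ v η = inner ℝ v (f k) := by
  have h1 := (innerSL ℝ v).hasSum h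
  have h2 := hasSum_single (f := fun l => innerSL ℝ v (f l)) k fun l hl =>
    inner_eq_zero_of_ne hl.symm hv (hf l)
  exact h1.unique h2

theorem inner_kernelVec_noisePart {n : ℕ} (hn : 1 ≤ n) {κ : ℝ≥0} (hκ : 0 < κ) (k : ℕ) {d : ℕ}
    (e : Fin d → ℝ) (σ : Fin d → Sph n) (x : Sph n) :
    inner ℝ (kernelVec n κ k x : L2 n κ) (noisePart n κ k e σ) =
      ∑ i, e i * (gegenbauer n κ k).eval (dot x (σ i)) := by
  simp [noisePart, inner_sum, inner_smul_right, inner_kernelVec_kernelVec hκ,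
    kernelFun_eq_gegenbauer hn hκ]

theorem layer_activation {n : ℕ} (hn : 1 ≤ n) {κ : ℝ≥0} (hκ : 0 < κ) (K : ℕ) (a : ℕ → ℝ)
    (x : Sph n) : layer n κ (activation n κ K a) x =
      ∑ k ∈ Finset.range (K + 1), a k • (kernelVec n κ k x : L2 n κ) := by
  simp only [coe_kernelVec, ← map_smul, ← map_sum, layer]
  congr 1
  ext z
  simp [activation, Polynomial.eval_finsetSum, kernelFun_eq_gegenbauer hn hκ]

theorem inner_layer_layer {n : ℕ} (hn : 1 ≤ n) {κ : ℝ≥0} (hκ : 0 < κ) (K : ℕ) (a : ℕ → ℝ)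
    (x y : Sph n) :
    inner ℝ (layer n κ (activation n κ K a) x) (layer n κ (activation n κ K a) y) =
      (gTheta n κ K a).eval (dot x y) := by
  rw [layer_activation hn hκ, layer_activation hn hκ, sum_inner]
  simp only [gTheta, Polynomial.eval_finsetSum]
  refine Finset.sum_congr rfl fun k hk => ?_
  rw [inner_sum, Finset.sum_eq_single k]
  · rw [inner_smul_left, inner_smul_right, inner_kernelVec_kernelVec hκ,
      kernelFun_eq_gegenbauer hn hκ, Polynomial.eval_smul, conj_trivial, smul_eq_mul]
    ring
  · intro l _ hl
    rw [inner_smul_left, inner_smul_right,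
      inner_eq_zero_of_ne hl.symm (kernelVec_mem n κ k x) (kernelVec_mem n κ l y)]
    simp
  · exact fun h => absurd hk h

theorem inner_layer_noise {n : ℕ} (hn : 1 ≤ n) {κ : ℝ≥0} (hκ : 0 < κ) (K : ℕ) (a : ℕ → ℝ)
    {η : L2 n κ} {d : ℕ → ℕ} {e : (k : ℕ) → Fin (d k) → ℝ} {σ : (k : ℕ) → Fin (d k) → Sph n}
    (hη : HasSum (fun k => noisePart n κ k (e k) (σ k)) η) (x : Sph n) :
    inner ℝ (layer n κ (activation n κ K a) x) η = ∑ k ∈ Finset.range (K + 1),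
      a k * ∑ i, e k i * (gegenbauer n κ k).eval (dot x (σ k i)) := by
  rw [layer_activation hn hκ, sum_inner]
  refine Finset.sum_congr rfl fun k _ => ?_
  rw [inner_smul_left, conj_trivial,
    inner_eq_inner_of_hasSum (fun k => noisePart_mem n κ k (e k) (σ k)) hη (kernelVec_mem n κ k x),
    inner_kernelVec_noisePart hn hκ]

/-- Up to a constant, the objective is `-2` times a sum of zonal functions. -/
theorem objective_eq {n : ℕ} (hn : 1 ≤ n) {κ : ℝ≥0} (hκ : 0 < κ) (K : ℕ) (a : ℕ → ℝ) (xs : Sph n)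
    {η : L2 n κ} {d : ℕ → ℕ} {e : (k : ℕ) → Fin (d k) → ℝ} {σ : (k : ℕ) → Fin (d k) → Sph n}
    (hη : HasSum (fun k => noisePart n κ k (e k) (σ k)) η) (x : Sph n) :
    objective n κ (activation n κ K a) (layer n κ (activation n κ K a) xs + η) x =
      ((gTheta n κ K a).eval 1 + ‖layer n κ (activation n κ K a) xs + η‖ ^ 2) -
        2 * ((gTheta n κ K a).eval (dot x xs) + ∑ k ∈ Finset.range (K + 1),
          a k * ∑ i, e k i * (gegenbauer n κ k).eval (dot x (σ k i))) := by
  rw [objective, norm_sub_sq_real, inner_add_right, inner_layer_layer hn hκ,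
    inner_layer_noise hn hκ K a hη, ← real_inner_self_eq_norm_sq (layer n κ _ x),
    inner_layer_layer hn hκ, dot_self]
  ring

/-! ### Critical points -/

/-- The differential of the restriction to the sphere of a function on the ambient space is the
restriction of its differential to the tangent space, the orthogonal complement of the point. -/
theorem IsCriticalPoint.apply_eq_zero {n : ℕ} {J : Sph n → ℝ} {x : Sph n} (hJ : IsCriticalPoint J x)
    {G : Amb n → ℝ} (hG : ∀ x : Sph n, J x = G x) {G' : Amb n →L[ℝ] ℝ}
    (hG' : HasFDerivAt G G' (x : Amb n)) {v : Amb n} (hv : inner ℝ (x : Amb n) v = 0) :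
    G' v = 0 := by
  have hJG : J = G ∘ ((↑) : Sph n → Amb n) := funext hG
  have : Fact (Module.finrank ℝ (Amb n) = n + 1) := ⟨finrank_euclideanSpace_fin⟩
  have hc : MDifferentiableAt (𝓡 n) 𝓘(ℝ, Amb n) ((↑) : Sph n → Amb n) x :=
    (contMDiff_coe_sphere (m := 1) x).mdifferentiableAt one_ne_zero
  have hGd : MDifferentiableAt 𝓘(ℝ, Amb n) 𝓘(ℝ, ℝ) G (x : Amb n) :=
    hG'.differentiableAt.mdifferentiableAt
  have hcomp := mfderiv_comp x hGd hc
  rw [← hJG, hJ, mfderiv_eq_fderiv, hG'.fderiv] at hcomp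
  have hr : v ∈ (mvfderiv (𝓡 n) ((↑) : Sph n → Amb n) x).range := by
    rw [range_mvfderiv_subtypeVal]
    exact Submodule.mem_orthogonal_singleton_iff_inner_right.2 hv
  obtain ⟨w, rfl⟩ := hr
  exact (congrArg (fun L => L w) hcomp).symm

theorem hasFDerivAt_eval_inner {E : Type*} [NormedAddCommGroup E] [InnerProductSpace ℝ E]
    (p : Polynomial ℝ) (x u : E) :
    HasFDerivAt (fun z : E => p.eval (inner ℝ z u))
      (p.derivative.eval (inner ℝ x u) • innerSL ℝ u) x := by
  have h : HasFDerivAt (fun z : E => inner ℝ z u) (innerSL ℝ u) x := by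
    simp only [real_inner_comm u]
    exact (innerSL ℝ u).hasFDerivAt
  exact (p.hasDerivAt (inner ℝ x u)).comp_hasFDerivAt x h

/-- The vector whose norm is `ε(x)`. -/
noncomputable def noiseGradient (n : ℕ) (κ : ℝ≥0) (K : ℕ) (a : ℕ → ℝ) (d : ℕ → ℕ)
    (e : (k : ℕ) → Fin (d k) → ℝ) (σ : (k : ℕ) → Fin (d k) → Sph n) (x : Sph n) : Amb n :=
  ∑ k ∈ Finset.range (K + 1), a k • ∑ i : Fin (d k),
    (e k i * (gegenbauer n κ k).derivative.eval (dot x (σ k i))) • (σ k i : Amb n)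

/-- At a critical point the tangential parts of the gradients of signal and noise cancel. -/
theorem slope_mul_inner_add_inner_noiseGradient_eq_zero {n : ℕ} (hn : 1 ≤ n) {κ : ℝ≥0} (hκ : 0 < κ)
    {K : ℕ} {a : ℕ → ℝ} {xs : Sph n}
    {η : L2 n κ} {d : ℕ → ℕ} {e : (k : ℕ) → Fin (d k) → ℝ} {σ : (k : ℕ) → Fin (d k) → Sph n}
    (hη : HasSum (fun k => noisePart n κ k (e k) (σ k)) η) {x : Sph n}
    (hx : IsCriticalPoint (objective n κ (activation n κ K a)
      (layer n κ (activation n κ K a) xs + η)) x) {v : Amb n} (hv : inner ℝ (x : Amb n) v = 0) :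
    (gTheta n κ K a).derivative.eval (dot x xs) * inner ℝ (xs : Amb n) v +
      inner ℝ (noiseGradient n κ K a d e σ x) v = 0 := by
  have hd := ((((hasFDerivAt_eval_inner (gTheta n κ K a) (x : Amb n) (xs : Amb n)).fun_add
    (HasFDerivAt.fun_sum fun k (_ : k ∈ Finset.range (K + 1)) =>
      (HasFDerivAt.fun_sum fun i (_ : i ∈ (Finset.univ : Finset (Fin (d k)))) =>
        (hasFDerivAt_eval_inner (gegenbauer n κ k) (x : Amb n) (σ k i : Amb n)).const_mul
          (e k i)).const_mul (a k))).const_mul 2).const_sub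
    ((gTheta n κ K a).eval 1 + ‖layer n κ (activation n κ K a) xs + η‖ ^ 2))
  have h := hx.apply_eq_zero (fun x => objective_eq hn hκ K a xs hη x) hd hv
  simp only [neg_apply, smul_apply, add_apply, sum_apply, innerSL_apply_apply, smul_eq_mul] at h
  have h2 : inner ℝ (noiseGradient n κ K a d e σ x) v = ∑ k ∈ Finset.range (K + 1), a k *
      ∑ i, e k i * ((gegenbauer n κ k).derivative.eval (inner ℝ (x : Amb n) (σ k i : Amb n)) *
        inner ℝ (σ k i : Amb n) v) := by
    simp only [noiseGradient, sum_inner, inner_smul_left, conj_trivial, dot, mul_assoc]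
  rw [h2, dot]
  linarith

/-- This comes from testing criticality with the tangential part `v = x♯ - (x · x♯) x` of `x♯`,
for which `‖v‖ ^ 2 = 1 - (x · x♯) ^ 2`. -/
theorem slopeInf_sq_mul_le {n : ℕ} (hn : 1 ≤ n) {κ : ℝ≥0} (hκ : 0 < κ)
    {K : ℕ} {a : ℕ → ℝ} {xs : Sph n}
    {η : L2 n κ} {d : ℕ → ℕ} {e : (k : ℕ) → Fin (d k) → ℝ} {σ : (k : ℕ) → Fin (d k) → Sph n}
    (hη : HasSum (fun k => noisePart n κ k (e k) (σ k)) η) {x : Sph n}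
    (hx : IsCriticalPoint (objective n κ (activation n κ K a)
      (layer n κ (activation n κ K a) xs + η)) x) :
    slopeInf n κ K a ^ 2 * (1 - dot x xs ^ 2) ≤ noiseGradientNorm n κ K a d e σ x ^ 2 := by
  set t := dot x xs with ht
  have htI := dot_mem_Icc x xs
  set T := slopeInf n κ K a
  have hT0 : 0 ≤ T := Real.sInf_nonneg (by rintro _ ⟨s, -, rfl⟩; exact abs_nonneg _)
  have hT : T ≤ |(gTheta n κ K a).derivative.eval t| :=
    csInf_le ⟨0, by rintro _ ⟨s, -, rfl⟩; exact abs_nonneg _⟩ ⟨t, htI, rfl⟩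
  let v : Amb n := (xs : Amb n) - t • (x : Amb n)
  have hxx : inner ℝ (x : Amb n) (x : Amb n) = (1 : ℝ) := dot_self x
  have hss : inner ℝ (xs : Amb n) (xs : Amb n) = (1 : ℝ) := dot_self xs
  have hxs : inner ℝ (x : Amb n) (xs : Amb n) = t := rfl
  have hsx : inner ℝ (xs : Amb n) (x : Amb n) = t := dot_comm xs x
  have hv : inner ℝ (x : Amb n) v = 0 := by
    simp only [v, inner_sub_right, inner_smul_right, hxx, hxs]; ring
  have hsv : inner ℝ (xs : Amb n) v = 1 - t ^ 2 := by
    simp only [v, inner_sub_right, inner_smul_right, hss, hsx]; ring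
  have hvv : ‖v‖ ^ 2 = 1 - t ^ 2 := by
    rw [← real_inner_self_eq_norm_sq]
    simp only [v, inner_sub_right, inner_sub_left, inner_smul_right, inner_smul_left, hss, hsx,
      hxs, hxx, conj_trivial]
    ring
  have h := slope_mul_inner_add_inner_noiseGradient_eq_zero hn hκ hη hx hv
  rw [← ht, hsv] at h
  have hcs := abs_real_inner_le_norm (noiseGradient n κ K a d e σ x) v
  rw [eq_neg_of_add_eq_zero_right h, abs_neg, abs_mul] at hcs
  have hε : ‖noiseGradient n κ K a d e σ x‖ = noiseGradientNorm n κ K a d e σ x := rfl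
  rw [hε] at hcs
  set ε := noiseGradientNorm n κ K a d e σ x
  rw [← hvv, abs_of_nonneg (sq_nonneg ‖v‖)] at hcs
  rw [← hvv]
  have h1 : T * ‖v‖ ≤ ε := by
    rcases (norm_nonneg v).eq_or_lt with h0 | h0
    · rw [← h0, mul_zero]; exact norm_nonneg _
    · refine le_of_mul_le_mul_right (le_trans ?_ hcs) h0
      rw [mul_assoc, ← sq]
      exact mul_le_mul_of_nonneg_right hT (sq_nonneg _)
  rw [← mul_pow]
  exact pow_le_pow_left₀ (mul_nonneg hT0 (norm_nonneg v)) h1 2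

/-- If `ε < T`, then `t ^ 2 ≥ 1 - ε ^ 2 / T ^ 2`, which exceeds `((T - ε) / (T + ε)) ^ 2`; if
`ε > T`, then the left side is negative. -/
theorem one_sub_two_mul_div_lt_abs {T ε t : ℝ} (hT : 0 ≤ T) (hε : 0 < ε) (hne : ε ≠ T)
    (h : T ^ 2 * (1 - t ^ 2) ≤ ε ^ 2) : 1 - 2 * ε / (T + ε) < |t| := by
  have hs : 0 < T + ε := by linarith
  have e1 : 1 - 2 * ε / (T + ε) = (T - ε) / (T + ε) := by field_simp; ring
  rw [e1]
  rcases lt_or_gt_of_ne hne.symm with hle | hlt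
  · exact (div_neg_of_neg_of_pos (by linarith) hs).trans_le (abs_nonneg t)
  · have hT' : 0 < T := by linarith
    refine abs_lt_of_sq_lt_sq ?_ (abs_nonneg t) |> (le_abs_self _).trans_lt
    rw [sq_abs, div_pow, div_lt_iff₀ (by positivity)]
    -- `t² ≥ (T - ε) (T + ε) / T²`, and `(T - ε) T² < (T + ε)³`
    have h1 : (T - ε) * (T + ε) ≤ t ^ 2 * T ^ 2 := by nlinarith
    have h2 : (T - ε) * T ^ 2 < (T + ε) ^ 3 := by
      have : 0 < ε * T ^ 2 := by positivity
      nlinarith [pow_pos hε 3, mul_pos hT' (pow_pos hε 2)]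
    have h3 : 0 < (T - ε) := by linarith
    have h4 : (T - ε) ^ 2 * T ^ 2 < t ^ 2 * (T + ε) ^ 2 * T ^ 2 := by
      calc (T - ε) ^ 2 * T ^ 2 = (T - ε) * ((T - ε) * T ^ 2) := by ring
        _ < (T - ε) * (T + ε) ^ 3 := mul_lt_mul_of_pos_left h2 h3
        _ = (T - ε) * (T + ε) * (T + ε) ^ 2 := by ring
        _ ≤ t ^ 2 * T ^ 2 * (T + ε) ^ 2 := by gcongr
        _ = _ := by ring
    exact lt_of_mul_lt_mul_right h4 (by positivity)

theorem one_sub_two_mul_div_le_abs {T ε t : ℝ} (hT : 0 ≤ T) (hε : 0 ≤ ε)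
    (h : T ^ 2 * (1 - t ^ 2) ≤ ε ^ 2) (hs : 0 < T + ε) : 1 - 2 * ε / (T + ε) ≤ |t| := by
  rcases eq_or_ne ε T with rfl | hne
  · have : 1 - 2 * ε / (ε + ε) = 0 := by rw [← two_mul] at hs ⊢; rw [div_self hs.ne', sub_self]
    rw [this]; exact abs_nonneg t
  rcases hε.eq_or_lt with rfl | hε
  · have hT' : 0 < T ^ 2 := by rw [add_zero] at hs; positivity
    have h1 : 1 ≤ t ^ 2 := by nlinarith
    simpa using (one_le_sq_iff_one_le_abs t).1 h1
  · exact (one_sub_two_mul_div_lt_abs hT hε hne h).le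

/-! ### Spherical designs and tight frames -/

theorem integrable_of_continuous {n : ℕ} {κ : ℝ≥0} {f : Sph n → ℝ} (hf : Continuous f) :
    Integrable f (sphereMeasure n κ) :=
  hf.integrable_of_hasCompactSupport (HasCompactSupport.of_compactSpace f)

theorem mass_pos (n : ℕ) {κ : ℝ≥0} (hκ : 0 < κ) : 0 < mass n κ := by
  rw [mass, measureReal_def, ENNReal.toReal_pos_iff]
  refine ⟨?_, measure_lt_top _ _⟩
  have h : (volume : Measure (Amb n)).toSphere ≠ 0 := Measure.toSphere_ne_zero _
  simp only [sphereMeasure, Measure.smul_apply]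
  exact pos_iff_ne_zero.2 (smul_ne_zero hκ.ne' (Measure.measure_univ_ne_zero.2 h))

theorem average_eq_integral_div_mass (n : ℕ) {κ : ℝ≥0} (hκ : 0 < κ) (f : Sph n → ℝ) :
    ⨍ x, f x ∂(volume : Measure (Amb n)).toSphere =
      (∫ x, f x ∂sphereMeasure n κ) / mass n κ := by
  have hκ' : (κ : ℝ) ≠ 0 := by exact_mod_cast hκ.ne'
  rw [average_eq, mass, sphereMeasure, integral_smul_nnreal_measure, measureReal_nnreal_smul_apply,
    NNReal.smul_def, smul_eq_mul, smul_eq_mul, mul_div_mul_left _ _ hκ', inv_mul_eq_div]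

/-- A design is nonempty: the empty mean is `0`, while the mean of `1` over the sphere is `1`. -/
theorem IsSphericalDesign.card_ne_zero {n s N : ℕ} {τ : Fin N → Sph n}
    (h : IsSphericalDesign s τ) : N ≠ 0 := by
  rintro rfl
  have h1 := h 1 (by simp)
  rw [average_eq_integral_div_mass n zero_lt_one] at h1
  simp only [restrictSphere_apply, map_one, integral_const, smul_eq_mul, mul_one] at h1
  rw [← mass, div_self (mass_pos n zero_lt_one).ne'] at h1
  simp at h1

theorem IsSphericalDesign.sum_eq {n s N : ℕ} {κ : ℝ≥0} (hκ : 0 < κ) {τ : Fin N → Sph n}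
    (h : IsSphericalDesign s τ) {p : MvPolynomial (Fin (n + 1)) ℝ} (hp : p.totalDegree ≤ s) :
    ∑ i, restrictSphere n p (τ i) =
      N / mass n κ * ∫ x, restrictSphere n p x ∂sphereMeasure n κ := by
  have hN : (N : ℝ) ≠ 0 := Nat.cast_ne_zero.2 h.card_ne_zero
  have h1 := h p hp
  rw [average_eq_integral_div_mass n hκ] at h1
  field_simp at h1 ⊢
  linarith

theorem isTightFrame_kernelVec_of_isSphericalDesign {n k N : ℕ} {κ : ℝ≥0} (hκ : 0 < κ)
    {τ : Fin N → Sph n} (h : IsSphericalDesign (2 * k) τ) :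
    IsTightFrame (fun i => kernelVec n κ k (τ i)) (N / mass n κ) := by
  refine ⟨div_pos (Nat.cast_pos.2 (Nat.pos_of_ne_zero h.card_ne_zero)) (mass_pos n hκ), ?_⟩
  rintro ⟨_, p, hp, rfl⟩
  have hdeg : (p ^ 2).totalDegree ≤ 2 * k :=
    (MvPolynomial.totalDegree_pow p 2).trans
      (Nat.mul_le_mul_left 2 (MvPolynomial.IsHomogeneous.totalDegree_le hp.1))
  have h1 := h.sum_eq hκ hdeg
  rw [Submodule.coe_norm]
  change ∑ i, inner ℝ (toL2 n κ (restrictSphere n p)) (kernelVec n κ k (τ i) : L2 n κ) ^ 2 =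
    N / mass n κ * ‖toL2 n κ (restrictSphere n p)‖ ^ 2
  simp only [inner_kernelVec hκ hp, norm_toL2_sq]
  simpa only [restrictSphere_apply, map_pow] using h1

/-! ### Trace of a tight frame of kernels -/

theorem inner_harmonicBasis_kernelVec (n : ℕ) (κ : ℝ≥0) (k : ℕ) (j : Fin (harmonicDim n κ k))
    (σ : Sph n) :
    inner ℝ (harmonicBasis n κ k j) (kernelVec n κ k σ) = harmonicFun n κ k j σ :=
  (harmonicBasis n κ k).orthonormal.inner_right_fintype (fun i => harmonicFun n κ k i σ) j

theorem sum_harmonicFun_sq {n : ℕ} (hn : 1 ≤ n) {κ : ℝ≥0} (hκ : 0 < κ) (k : ℕ) (σ : Sph n) :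
    ∑ j, harmonicFun n κ k j σ ^ 2 = (gegenbauer n κ k).eval 1 := by
  have h := kernelFun_eq_gegenbauer hn hκ k σ σ
  rw [dot_self] at h
  simp [← h, kernelFun, sq]

/-- The kernel is constant on the diagonal, and its integral there is the dimension of `H_k`. -/
theorem harmonicDim_eq {n : ℕ} (hn : 1 ≤ n) {κ : ℝ≥0} (hκ : 0 < κ) (k : ℕ) :
    (harmonicDim n κ k : ℝ) = mass n κ * (gegenbauer n κ k).eval 1 := by
  have h1 : ∀ j, ∫ x, harmonicFun n κ k j x ^ 2 ∂sphereMeasure n κ = 1 := by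
    intro j
    rw [← norm_toL2_sq, toL2_harmonicFun, ← Submodule.coe_norm,
      (harmonicBasis n κ k).orthonormal.1 j, one_pow]
  have h2 : ∑ j, ∫ x, harmonicFun n κ k j x ^ 2 ∂sphereMeasure n κ = harmonicDim n κ k := by
    simp [h1]
  rw [← h2, ← integral_finsetSum _ fun j _ =>
    integrable_of_continuous ((harmonicFun n κ k j).continuous.fun_pow 2)]
  simp only [sum_harmonicFun_sq hn hκ, integral_const, smul_eq_mul]
  rfl

/-- The value `φ_{n,k}(1)` is `dim H_k / m`, so it vanishes only if `H_k` is trivial. -/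
theorem gegenbauer_eq_zero_of_eval_one {n : ℕ} (hn : 1 ≤ n) {κ : ℝ≥0} (hκ : 0 < κ) {k : ℕ}
    (h : (gegenbauer n κ k).eval 1 = 0) : gegenbauer n κ k = 0 := by
  have h1 := harmonicDim_eq hn hκ k
  rw [h, mul_zero, Nat.cast_eq_zero] at h1
  refine polynomial_eq_of_eval_dot hn fun σ τ => ?_
  rw [← kernelFun_eq_gegenbauer hn hκ, kernelFun]
  have : IsEmpty (Fin (harmonicDim n κ k)) := by rw [h1]; infer_instance
  simp

/-- The constant of a tight frame of `N` kernels is `N / m`, by comparing traces: all kernels have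
the same norm. -/
theorem IsTightFrame.card_eq {n : ℕ} (hn : 1 ≤ n) {κ : ℝ≥0} (hκ : 0 < κ) {k N : ℕ}
    {σ : Fin N → Sph n} {c : ℝ} (h : IsTightFrame (fun i => kernelVec n κ k (σ i)) c)
    (hk : (gegenbauer n κ k).eval 1 ≠ 0) : (N : ℝ) = c * mass n κ := by
  have h1 : ∑ j, ∑ i, inner ℝ (harmonicBasis n κ k j) (kernelVec n κ k (σ i)) ^ 2 =
      c * harmonicDim n κ k := by
    simp only [h.2, (harmonicBasis n κ k).orthonormal.1]
    simp [mul_comm]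
  rw [Finset.sum_comm] at h1
  simp only [inner_harmonicBasis_kernelVec, sum_harmonicFun_sq hn hκ, harmonicDim_eq hn hκ,
    Finset.sum_const, Finset.card_univ, Fintype.card_fin, nsmul_eq_mul, ← mul_assoc] at h1
  exact mul_right_cancel₀ hk h1

/-! ### Second moments -/

/-- By rotation invariance the second moment is the same in all directions, and over an orthonormal
basis the second moments add up to the mass. -/
theorem integral_dot_sq {n : ℕ} (κ : ℝ≥0) (u : Sph n) :
    ∫ x, dot x u ^ 2 ∂sphereMeasure n κ = mass n κ / (n + 1) := by
  let b : Fin (n + 1) → Sph n := fun j => ⟨EuclideanSpace.single j 1, by simp⟩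
  have hb : ∀ x j, dot x (b j) = (x : Amb n) j := by
    intro x j
    simp [dot, b, EuclideanSpace.inner_single_right]
  have hcont : ∀ v : Sph n, Continuous fun x : Sph n => dot x v ^ 2 := by
    intro v; unfold dot; fun_prop
  have h1 : ∀ j, ∫ x, dot x (b j) ^ 2 ∂sphereMeasure n κ =
      ∫ x, dot x u ^ 2 ∂sphereMeasure n κ := by
    intro j
    obtain ⟨g, hg⟩ := exists_rot_eq u (b j)
    rw [← integral_comp_rot κ g]
    simp only [← hg, dot_rot_rot]
  have h2 : ∑ j, ∫ x, dot x (b j) ^ 2 ∂sphereMeasure n κ = mass n κ := by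
    rw [← integral_finsetSum _ fun j _ => integrable_of_continuous (hcont (b j))]
    have h3 : ∀ x : Sph n, ∑ j, dot x (b j) ^ 2 = 1 := by
      intro x
      have := EuclideanSpace.norm_sq_eq (x : Amb n)
      simp only [norm_eq_of_mem_sphere, one_pow, Real.norm_eq_abs, sq_abs] at this
      simp only [hb, ← this]
    simp only [h3, integral_const, smul_eq_mul, mul_one]
    rfl
  simp only [h1, Finset.sum_const, Finset.card_univ, Fintype.card_fin, nsmul_eq_mul] at h2
  rw [eq_div_iff (by positivity), ← h2]
  push_cast
  ring

theorem IsSphericalDesign.sum_dot_sq {n s N : ℕ} {τ : Fin N → Sph n}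
    (h : IsSphericalDesign s τ) (hs : 2 ≤ s) (u : Sph n) :
    ∑ i, dot (τ i) u ^ 2 = N * (1 / (n + 1)) := by
  let p : MvPolynomial (Fin (n + 1)) ℝ :=
    (∑ j, MvPolynomial.C ((u : Amb n) j) * MvPolynomial.X j) ^ 2
  have hp : p.IsHomogeneous 2 := by
    have := MvPolynomial.IsHomogeneous.sum Finset.univ
      (fun j => MvPolynomial.C ((u : Amb n) j) * MvPolynomial.X j) 1 fun j _ => by
        simpa using (MvPolynomial.isHomogeneous_C (Fin (n + 1)) ((u : Amb n) j)).mul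
          (MvPolynomial.isHomogeneous_X ℝ j)
    simpa using this.pow 2
  have hpd : ∀ x : Sph n, restrictSphere n p x = dot x u ^ 2 := by
    intro x
    simp [restrictSphere_apply, p, dot, PiLp.inner_apply]
  have h1 := h.sum_eq zero_lt_one (hp.totalDegree_le.trans hs)
  simp only [hpd, integral_dot_sq] at h1
  rw [h1]
  have := (mass_pos n zero_lt_one).ne'
  field_simp

/-! ### Bounds for the noise gradient -/

theorem abs_le_slopeMax (n : ℕ) (κ : ℝ≥0) (k : ℕ) (x y : Sph n) :
    |(gegenbauer n κ k).derivative.eval (dot x y)| ≤ slopeMax n κ k :=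
  le_csSup (isCompact_Icc.bddAbove_image (by fun_prop)) ⟨_, dot_mem_Icc x y, rfl⟩

/-- Pairing the sum with the unit vector in its direction reduces this to the Cauchy–Schwarz
inequality. -/
theorem norm_sum_smul_sphere_le {n N : ℕ} {σ : Fin N → Sph n} {e f : Fin N → ℝ} {M β : ℝ}
    (hβ0 : 0 ≤ β) (hf : ∀ i, |f i| ≤ M)
    (hβ : ∀ u : Sph n, ∑ i, dot (σ i) u ^ 2 ≤ β) :
    ‖∑ i, (e i * f i) • (σ i : Amb n)‖ ^ 2 ≤ M ^ 2 * (∑ i, e i ^ 2) * β := by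
  set w := ∑ i, (e i * f i) • (σ i : Amb n) with hw
  rcases eq_or_ne w 0 with h0 | h0
  · have : 0 ≤ ∑ i, e i ^ 2 := Finset.sum_nonneg fun i _ => sq_nonneg _
    rw [h0, norm_zero, zero_pow two_ne_zero]
    positivity
  · let u : Sph n := ⟨‖w‖⁻¹ • w, by simp [norm_smul, h0]⟩
    have h1 : ‖w‖ = ∑ i, e i * (f i * dot (σ i) u) := by
      have h2 : inner ℝ w (u : Amb n) = ‖w‖ := by
        simp only [u, inner_smul_right, real_inner_self_eq_norm_sq]
        field_simp
      rw [← h2]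
      conv_lhs => rw [hw]
      simp only [sum_inner, inner_smul_left, conj_trivial, mul_assoc]
      rfl
    rw [h1, mul_comm (M ^ 2), mul_assoc]
    refine (Finset.sum_mul_sq_le_sq_mul_sq _ _ _).trans ?_
    refine mul_le_mul_of_nonneg_left ?_ (Finset.sum_nonneg fun i _ => sq_nonneg _)
    calc ∑ i, (f i * dot (σ i) u) ^ 2 ≤ ∑ i, M ^ 2 * dot (σ i) u ^ 2 := by
          refine Finset.sum_le_sum fun i _ => ?_
          rw [mul_pow]
          exact mul_le_mul_of_nonneg_right (sq_le_sq' (abs_le.1 (hf i)).1 (abs_le.1 (hf i)).2)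
            (sq_nonneg _)
      _ = M ^ 2 * ∑ i, dot (σ i) u ^ 2 := by rw [Finset.mul_sum]
      _ ≤ M ^ 2 * β := mul_le_mul_of_nonneg_left (hβ u) (sq_nonneg M)

/-- The degree `k` part of the noise gradient, for coefficients given by a tight frame of kernels.
The tight frame property turns `∑ e_i ^ 2` into `‖η_k‖ ^ 2 / c`, and the number of kernels
is `c m`. -/
theorem norm_noiseGradient_degree_le {n : ℕ} (hn : 1 ≤ n) {κ : ℝ≥0} (hκ : 0 < κ)
    {η : L2 n κ} {d : ℕ → ℕ} {e : (k : ℕ) → Fin (d k) → ℝ} {σ : (k : ℕ) → Fin (d k) → Sph n}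
    (hη : HasSum (fun k => noisePart n κ k (e k) (σ k)) η) {k : ℕ} {c β : ℝ} (hβ : 0 ≤ β)
    (hc : IsTightFrame (fun i => kernelVec n κ k (σ k i)) c)
    (he : ∀ i, e k i = (1 / c) * inner ℝ η (kernelVec n κ k (σ k i) : L2 n κ))
    (hσ : ∀ u : Sph n, ∑ i, dot (σ k i) u ^ 2 ≤ d k * β) (x : Sph n) :
    ‖∑ i, (e k i * (gegenbauer n κ k).derivative.eval (dot x (σ k i))) • (σ k i : Amb n)‖ ≤
      √(mass n κ * β) * (slopeMax n κ k * ‖noisePart n κ k (e k) (σ k)‖) := by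
  have hM : 0 ≤ slopeMax n κ k := Real.sSup_nonneg (by rintro _ ⟨t, -, rfl⟩; exact abs_nonneg _)
  -- if `H_k` is trivial, then the number of kernels need not be `c m`, but the left side vanishes
  by_cases hk : (gegenbauer n κ k).eval 1 = 0
  · rw [gegenbauer_eq_zero_of_eval_one hn hκ hk]
    simp only [Polynomial.derivative_zero, Polynomial.eval_zero, mul_zero, zero_smul,
      Finset.sum_const_zero, norm_zero]
    positivity
  have hc0 := hc.1
  have hsum : ∑ i, e k i ^ 2 = (1 / c) * ‖noisePart n κ k (e k) (σ k)‖ ^ 2 := by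
    have h1 := hc.2 ⟨_, noisePart_mem n κ k (e k) (σ k)⟩
    simp only [Submodule.coe_inner, Submodule.coe_norm] at h1
    have h2 : ∀ i, e k i = (1 / c) *
        inner ℝ (noisePart n κ k (e k) (σ k)) (kernelVec n κ k (σ k i) : L2 n κ) := by
      intro i
      rw [he i, real_inner_comm, inner_eq_inner_of_hasSum
        (fun k => noisePart_mem n κ k (e k) (σ k)) hη (kernelVec_mem n κ k _), real_inner_comm]
    calc ∑ i, e k i ^ 2 = ∑ i, (1 / c) ^ 2 *
          inner ℝ (noisePart n κ k (e k) (σ k)) (kernelVec n κ k (σ k i) : L2 n κ) ^ 2 :=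
          Finset.sum_congr rfl fun i _ => by rw [← mul_pow, ← h2 i]
      _ = (1 / c) ^ 2 * (c * ‖noisePart n κ k (e k) (σ k)‖ ^ 2) := by rw [← Finset.mul_sum, h1]
      _ = _ := by field_simp
  have h3 := norm_sum_smul_sphere_le (e := e k) (by positivity)
    (fun i => abs_le_slopeMax n κ k x (σ k i)) hσ
  rw [hsum, hc.card_eq hn hκ hk] at h3
  have hm := (mass_pos n hκ).le
  refine le_of_sq_le_sq (h3.trans_eq ?_) (by positivity)
  rw [mul_pow, Real.sq_sqrt (by positivity)]
  field_simp

/-- The bound of the noise gradient, for points whose second moments in all directions are at most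
`β` times their number: `β = 1` always works, and `β = 1 / (n + 1)` for spherical designs. -/
theorem noiseGradientNorm_le {n : ℕ} (hn : 1 ≤ n) {κ : ℝ≥0} (hκ : 0 < κ) (K : ℕ) (a : ℕ → ℝ)
    {η : L2 n κ} {d : ℕ → ℕ} {e : (k : ℕ) → Fin (d k) → ℝ} {σ : (k : ℕ) → Fin (d k) → Sph n}
    (hη : HasSum (fun k => noisePart n κ k (e k) (σ k)) η) {c : ℕ → ℝ} {β : ℝ} (hβ : 0 ≤ β)
    (hc : ∀ k ∈ Finset.Icc 1 K, IsTightFrame (fun i => kernelVec n κ k (σ k i)) (c k) ∧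
      ∀ i, e k i = (1 / c k) * inner ℝ η (kernelVec n κ k (σ k i) : L2 n κ))
    (hσ : ∀ k ∈ Finset.Icc 1 K, ∀ u : Sph n, ∑ i, dot (σ k i) u ^ 2 ≤ d k * β) (x : Sph n) :
    noiseGradientNorm n κ K a d e σ x ≤ √(mass n κ * β) * ∑ k ∈ Finset.Icc 1 K,
      slopeMax n κ k * |a k| * ‖noisePart n κ k (e k) (σ k)‖ := by
  have hsub : Finset.Icc 1 K ⊆ Finset.range (K + 1) := fun k hk => by
    simp only [Finset.mem_Icc, Finset.mem_range] at hk ⊢; omega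
  -- the term of degree `0` vanishes because `φ_{n,0}` is constant
  rw [noiseGradientNorm, ← Finset.sum_subset hsub fun k hk hk' => by
    have : k = 0 := by simp only [Finset.mem_Icc, Finset.mem_range] at hk hk'; omega
    subst this
    simp [derivative_gegenbauer_zero hn hκ]]
  refine (norm_sum_le _ _).trans ?_
  rw [Finset.mul_sum]
  refine Finset.sum_le_sum fun k hk => ?_
  rw [norm_smul, Real.norm_eq_abs]
  have h := norm_noiseGradient_degree_le hn hκ hη hβ (hc k hk).1 (hc k hk).2 (hσ k hk) x
  exact (mul_le_mul_of_nonneg_left h (abs_nonneg (a k))).trans_eq (by ring)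

theorem sum_dot_sq_le_card {n N : ℕ} (σ : Fin N → Sph n) (u : Sph n) :
    ∑ i, dot (σ i) u ^ 2 ≤ N * 1 := by
  have h : ∀ i, dot (σ i) u ^ 2 ≤ 1 := fun i => by
    have := dot_mem_Icc (σ i) u
    rw [sq_le_one_iff_abs_le_one]; exact abs_le.2 this
  simpa using Finset.sum_le_sum fun i (_ : i ∈ Finset.univ) => h i

end SUNLayer

/-! ### Critical points and noise bounds of the denoising problem -/

theorem mainTheorem1 (n : ℕ) (hn : 1 ≤ n) (κ : NNReal) (hκ : 0 < κ)
    (K : ℕ) (a : ℕ → ℝ) (xs : SUNLayer.Sph n) (η : SUNLayer.L2 n κ)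
    (d : ℕ → ℕ) (e : (k : ℕ) → Fin (d k) → ℝ) (σ : (k : ℕ) → Fin (d k) → SUNLayer.Sph n)
    (hη : HasSum (fun k => SUNLayer.noisePart n κ k (e k) (σ k)) η) :
    -- (a) critical points
    (∀ x : SUNLayer.Sph n,
      SUNLayer.IsCriticalPoint
        (SUNLayer.objective n κ (SUNLayer.activation n κ K a)
          (SUNLayer.layer n κ (SUNLayer.activation n κ K a) xs + η)) x →
      let T := SUNLayer.slopeInf n κ K a
      let ε := SUNLayer.noiseGradientNorm n κ K a d e σ x
      (0 < T + ε → 1 - 2 * ε / (T + ε) ≤ |SUNLayer.dot x xs|) ∧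
      (0 < ε → ε ≠ T → 1 - 2 * ε / (T + ε) < |SUNLayer.dot x xs|)) ∧
    -- spherical designs give tight frames of reproducing kernels
    (∀ k N : ℕ, ∀ τ : Fin N → SUNLayer.Sph n, SUNLayer.IsSphericalDesign (2 * k) τ →
      SUNLayer.IsTightFrame (fun i => SUNLayer.kernelVec n κ k (τ i))
        (N / SUNLayer.mass n κ)) ∧
    -- (b) noise written in tight frames of reproducing kernels
    (∀ c : ℕ → ℝ,
      (∀ k ∈ Finset.Icc 1 K,
        SUNLayer.IsTightFrame (fun i => SUNLayer.kernelVec n κ k (σ k i)) (c k) ∧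
        ∀ i, e k i = (1 / c k) * inner ℝ η (SUNLayer.kernelVec n κ k (σ k i) : SUNLayer.L2 n κ)) →
      ∀ x : SUNLayer.Sph n,
        SUNLayer.noiseGradientNorm n κ K a d e σ x ≤
          √(SUNLayer.mass n κ) * ∑ k ∈ Finset.Icc 1 K,
            SUNLayer.slopeMax n κ k * |a k| * ‖SUNLayer.noisePart n κ k (e k) (σ k)‖ ∧
        ((∀ k ∈ Finset.Icc 1 K, SUNLayer.IsSphericalDesign (2 * k) (σ k)) →
          SUNLayer.noiseGradientNorm n κ K a d e σ x ≤
            √(SUNLayer.mass n κ / (n + 1)) * ∑ k ∈ Finset.Icc 1 K,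
              SUNLayer.slopeMax n κ k * |a k| * ‖SUNLayer.noisePart n κ k (e k) (σ k)‖)) := by

  open SUNLayer in
  refine ⟨fun x hx => ?_, fun k N τ hτ => isTightFrame_kernelVec_of_isSphericalDesign hκ hτ,
    fun c hc x => ⟨?_, fun hdes => ?_⟩⟩
  · intro T ε
    have hT : 0 ≤ T := Real.sInf_nonneg (by rintro _ ⟨s, -, rfl⟩; exact abs_nonneg _)
    have hε : 0 ≤ ε := norm_nonneg _
    have h := slopeInf_sq_mul_le hn hκ hη hx
    exact ⟨fun hs => one_sub_two_mul_div_le_abs hT hε h hs,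
      fun hε hne => one_sub_two_mul_div_lt_abs hT hε hne h⟩
  · simpa only [mul_one] using noiseGradientNorm_le hn hκ K a hη zero_le_one hc
      (fun k _ => sum_dot_sq_le_card (σ k)) x
  · rw [div_eq_mul_one_div (mass n κ)]
    refine noiseGradientNorm_le hn hκ K a hη (by positivity) hc (fun k hk u => ?_) x
    have hk' : 2 ≤ 2 * k := by have := (Finset.mem_Icc.1 hk).1; omega
    exact ((hdes k hk).sum_dot_sq hk' u).le
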